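/- Let $d\ge 2$ and let $\Omega\subset\mathbb R^d$ be a bounded connected domain with a finite conforming subdivision $\mathbb T_h$ of $\overline\Omega$ into nondegenerate closed simplices and parallelotopes ($\Omega$ is the interior of the union of the elements; two elements meet in a common, possibly empty, face). Let $h$ be the largest element diameter, $\Gamma_i$ the set of interior $(d-1)$-dimensional faces, each with a unit normal $\mathbf n_F$ pointing from $T_-$ to $T_+$, and put $[\phi]=\phi|_{T_-}-\phi|_{T_+}$, $\{\phi\}=\tfrac12(\phi|_{T_-}+\phi|_{T_+})$. Let $\Gamma_{pN}$ and $\Gamma_{uD}$ be sets of boundary faces, $\Gamma_{uD}\neq\emptyset$, and let $\mathbf n$ be the exterior unit normal on $\partial\Omega$. Let $\mathbf X_h\subset H^{\mathrm{div}}(\Omega)$ be a finite-dimensional space of vector fields that are polynomial on each element, let $\mathbf W_h=\{\mathbf z\in\mathbf X_h:\mathbf z\cdot\mathbf n=0\text{ on }\Gamma_{pN}\}$ and $\mathbf V_h=\{\mathbf v\in\mathbf X_h:\mathbf v\cdot\mathbf n=0\text{ on }\Gamma_{uD}\}$, and let $Q_h$ be a space of piecewise polynomial functions with $$\operatorname{div}\mathbf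 W_h=Q_h=\operatorname{div}\mathbf V_h .$$ With $\epsilon(\mathbf u)=\frac12(\nabla\mathbf u+(\nabla\mathbf u)^T)$ and a parameter $\gamma>0$ let $$\begin{aligned} d_h(\mathbf u,\mathbf v)={}&2(\epsilon(\mathbf u),\epsilon(\mathbf v))_{\mathbb T_h}+\tfrac{\gamma}{h}([\mathbf u],[\mathbf v])_{\Gamma_i}-2(\{\epsilon(\mathbf u)\mathbf n_F\},[\mathbf v])_{\Gamma_i}-2(\{\epsilon(\mathbf v)\mathbf n_F\},[\mathbf u])_{\Gamma_i}\\&+\tfrac{\gamma}{h}(\mathbf u,\mathbf v)_{\Gamma_{uD}}-2(\epsilon(\mathbf u)\mathbf n,\mathbf v)_{\Gamma_{uD}}-2(\epsilon(\mathbf v)\mathbf n,\mathbf u)_{\Gamma_{uD}},\\ a_h(\mathbf u,\mathbf v)={}&\mu\, d_h(\mathbf u,\mathbf v)+\lambda(\operatorname{div}\mathbf u,\operatorname{div}\mathbf v)_\Omega ,\end{aligned}$$ where $(\cdot,\cdot)$ with an index denotes the $L^2$ inner product on $\Omega$, respectively the sum of the $L^2$ inner products over the elements or faces. Call $\gamma$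 *admissible* if $d_h$ is coercive on $\mathbf V_h$: there is $\kappa>0$ with $\kappa\|\mathbf v\|_{1,h}^2\le d_h(\mathbf v,\mathbf v)$ for all $\mathbf v\in\mathbf V_h$, where $\|\mathbf v\|_{1,h}^2=\sum_{T\in\mathbb T_h}\|\nabla\mathbf v\|_T^2+\sum_{F\in\Gamma_i}\frac\gamma h\|[\mathbf v]\|_F^2+\sum_{F\in\Gamma_{uD}}\frac\gamma h\|\mathbf v\|_F^2$. Then: 1. All sufficiently large $\gamma$ are admissible, with a threshold that depends only on the mesh, $\Gamma_{uD}$ and the discrete spaces. 2. Let $\gamma>0$ be admissible, $\mu>0$, $\lambda\ge0$, $c_s\ge0$ (including $c_s=0$), $\alpha\in\mathbb R$, and let $K\in\mathbb R^{d\times d}$ be symmetric positive definite. For every $\sigma>0$ the system $$\begin{aligned}(\sigma(c_sp_h+\alpha\operatorname{div}\mathbf u_h),q)_\Omega+(\operatorname{div}\mathbf w_h,q)_\Omega&=0&&\forall q\in Q_h,\\ (K^{-1}\mathbf w_h,\mathbf z)_\Omega-(p_h,\operatorname{div}\mathbf z)_\Omega&=0&&\forall\mathbf z\in\mathbf W_h,\\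 a_h(\mathbf u_h,\mathbf v)-\alpha(p_h,\operatorname{div}\mathbf v)_\Omega&=0&&\forall\mathbf v\in\mathbf V_h\end{aligned}$$ has in $Q_h\times\mathbf W_h\times\mathbf V_h$ exactly one solution, $(p_h,\mathbf w_h,\mathbf u_h)=\mathbf 0$. 3. If moreover $\alpha\ne0$ or $c_s>0$, the semi-discrete scheme is uniquely solvable: for all time-dependent linear functionals $F(t)$ on $Q_h$, $G(t)$ on $\mathbf W_h$ (continuous in $t\ge0$) and $R(t)$ on $\mathbf V_h$ (continuously differentiable in $t\ge0$) and all $p^0\in Q_h$, $\mathbf u^0\in\mathbf V_h$ with $a_h(\mathbf u^0,\mathbf v)-\alpha(p^0,\operatorname{div}\mathbf v)_\Omega=R(0)(\mathbf v)$ for all $\mathbf v\in\mathbf V_h$, there is exactly one triple of continuous functions $(p_h,\mathbf w_h,\mathbf u_h):[0,\infty)\to Q_h\times\mathbf W_h\times\mathbf V_h$ such that $p_h(0)=p^0$, $\mathbf u_h(0)=\mathbf u^0$ and, for all $t>0$, $$\begin{aligned}\tfrac{d}{dt}(c_sp_h+\alpha\operatorname{div}\mathbf u_h,q)_\Omega+(\operatorname{div}\mathbf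 w_h,q)_\Omega&=F(t)(q)&&\forall q\in Q_h,\\ (K^{-1}\mathbf w_h,\mathbf z)_\Omega-(p_h,\operatorname{div}\mathbf z)_\Omega&=G(t)(\mathbf z)&&\forall\mathbf z\in\mathbf W_h,\\ a_h(\mathbf u_h,\mathbf v)-\alpha(p_h,\operatorname{div}\mathbf v)_\Omega&=R(t)(\mathbf v)&&\forall\mathbf v\in\mathbf V_h,\end{aligned}$$ where the derivative is required to exist. -/

import Mathlib

namespace Biot

noncomputable section

/-- The space `ℝᵈ` with its Euclidean norm. -/
abbrev E (d : ℕ) := EuclideanSpace ℝ (Fin d)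

/-! ### Meshes -/

/-- A nondegenerate closed `d`-simplex in `ℝᵈ`. -/
def IsSimplex {d : ℕ} (T : Set (E d)) : Prop :=
  ∃ p : Fin (d + 1) → E d, AffineIndependent ℝ p ∧ T = convexHull ℝ (Set.range p)

/-- A nondegenerate closed parallelotope in `ℝᵈ` (a parallelogram for `d = 2`, a parallelepiped
for `d = 3`). -/
def IsParallelotope {d : ℕ} (T : Set (E d)) : Prop :=
  ∃ (a : E d) (b : Fin d → E d), LinearIndependent ℝ b ∧
    T = (fun x => a + x) '' parallelepiped b

/-- `F` is a face of codimension one of the convex polytope `T`. -/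
def IsFacet {d : ℕ} (T F : Set (E d)) : Prop :=
  F.Nonempty ∧ IsExposed ℝ T F ∧ Module.finrank ℝ (vectorSpan ℝ F) + 1 = d

/-- `n` is the unit normal to the face `F` of `T` that points out of `T`: the face is the set of
points of `T` that are extremal in direction `n`. -/
def IsOuterNormal {d : ℕ} (T F : Set (E d)) (n : E d) : Prop :=
  ‖n‖ = 1 ∧ F = {x ∈ T | ∀ y ∈ T, inner ℝ n y ≤ inner ℝ n x}

/-- A conforming mesh of simplices and parallelotopes. The elements are indexed by `ι`, the interior
faces by `I` and the boundary faces by `B`. Every interior face carries a unit normal, which points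
from the element `minus` to the element `plus`; every boundary face carries the exterior
unit normal. -/
structure Mesh (d : ℕ) (ι I B : Type*) where
  /-- the (closed) mesh elements -/
  elem : ι → Set (E d)
  elem_injective : Function.Injective elem
  shape : ∀ T, IsSimplex (elem T) ∨ IsParallelotope (elem T)
  /-- any two elements meet in a common (possibly empty) face; the condition for the pair `(S, T)`
  says that the intersection is also a face of the other element -/
  conforming : ∀ T S, IsExposed ℝ (elem T) (elem T ∩ elem S)
  /-- the interior faces: faces shared by two elements -/
  iface : I → Set (E d)
  iface_injective : Function.Injective iface
  range_iface : Set.range iface =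
    {F | ∃ T S, T ≠ S ∧ IsFacet (elem T) F ∧ IsFacet (elem S) F}
  minus : I → ι
  plus : I → ι
  minus_ne_plus : ∀ F, minus F ≠ plus F
  facet_minus : ∀ F, IsFacet (elem (minus F)) (iface F)
  facet_plus : ∀ F, IsFacet (elem (plus F)) (iface F)
  inormal : I → E d
  inormal_outer : ∀ F, IsOuterNormal (elem (minus F)) (iface F) (inormal F)
  /-- the boundary faces: faces of elements that lie on the boundary of the domain -/
  bface : B → Set (E d)
  bface_injective : Function.Injective bface
  range_bface : Set.range bface =
    {F | (∃ T, IsFacet (elem T) F) ∧ F ⊆ frontier (interior (⋃ T, elem T))}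
  /-- the element to which a boundary face belongs -/
  owner : B → ι
  facet_owner : ∀ F, IsFacet (elem (owner F)) (bface F)
  bnormal : B → E d
  bnormal_outer : ∀ F, IsOuterNormal (elem (owner F)) (bface F) (bnormal F)

/-! ### Piecewise polynomial functions

A piecewise polynomial function is stored through the polynomials that represent it on the
elements; since elements have nonempty interior, these are determined by the function. -/

/-- Piecewise polynomial scalar functions (no continuity between elements). -/
abbrev Scal (d : ℕ) (ι : Type*) := ι → MvPolynomial (Fin d) ℝ

/-- Piecewise polynomial vector fields (no continuity between elements). -/
abbrev Vect (d : ℕ) (ι : Type*) := ι → Fin d → MvPolynomial (Fin d) ℝ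

/-- The value of a polynomial at a point of `ℝᵈ`. -/
def val {d : ℕ} (f : MvPolynomial (Fin d) ℝ) (x : E d) : ℝ := MvPolynomial.eval (fun j => x j) f

/-- The elementwise divergence. -/
def divB (d : ℕ) (ι : Type*) : Vect d ι →ₗ[ℝ] Scal d ι where
  toFun v := fun T => ∑ j, MvPolynomial.pderiv j (v T j)
  map_add' u v := by
    funext T
    simp [Finset.sum_add_distrib]
  map_smul' c v := by
    funext T
    simp [Finset.smul_sum]

/-- The entry `∂ⱼ vᵢ` of the gradient of a polynomial vector field. -/
def grad {d : ℕ} (v : Fin d → MvPolynomial (Fin d) ℝ) (i j : Fin d) (x : E d) : ℝ :=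
  val (MvPolynomial.pderiv j (v i)) x

/-- The entry `i j` of the strain `ε(v) = (∇v + (∇v)ᵀ) / 2` of a polynomial vector field. -/
def strain {d : ℕ} (v : Fin d → MvPolynomial (Fin d) ℝ) (i j : Fin d) (x : E d) : ℝ :=
  (grad v i j x + grad v j i x) / 2

/-- The component `i` of `ε(v) n`. -/
def strainN {d : ℕ} (v : Fin d → MvPolynomial (Fin d) ℝ) (n : E d) (i : Fin d) (x : E d) : ℝ :=
  ∑ j, strain v i j x * n j

namespace Mesh

variable {d : ℕ} {ι I B : Type*}

/-- The domain `Ω` that is subdivided by the mesh. -/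
def domain (M : Mesh d ι I B) : Set (E d) := interior (⋃ T, M.elem T)

/-- The mesh size: the largest diameter of an element. -/
def size (M : Mesh d ι I B) : ℝ := ⨆ T, Metric.diam (M.elem T)

/-- The integral over a face with respect to the surface measure. -/
def faceInt (F : Set (E d)) (f : E d → ℝ) : ℝ :=
  ∫ x in F, f x ∂(MeasureTheory.Measure.euclideanHausdorffMeasure (d - 1))

/-- The jump of the component `i` of `v` across an interior face. -/
def jump (M : Mesh d ι I B) (v : Vect d ι) (F : I) (i : Fin d) (x : E d) : ℝ :=
  val (v (M.minus F) i) x - val (v (M.plus F) i) x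

/-- The average of the component `i` of `ε(v) n_F` on an interior face. -/
def avgStrainN (M : Mesh d ι I B) (v : Vect d ι) (F : I) (i : Fin d) (x : E d) : ℝ :=
  (strainN (v (M.minus F)) (M.inormal F) i x + strainN (v (M.plus F)) (M.inormal F) i x) / 2

section Forms

variable [Fintype ι]

/-- The `L²(Ω)` inner product of scalar functions. -/
def innerS (M : Mesh d ι I B) (p q : Scal d ι) : ℝ :=
  ∑ T, ∫ x in M.elem T, val (p T) x * val (q T) x

/-- `(A w, z)_Ω` for a matrix `A`. -/
def innerV (M : Mesh d ι I B) (A : Matrix (Fin d) (Fin d) ℝ) (w z : Vect d ι) : ℝ :=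
  ∑ T, ∫ x in M.elem T, ∑ i, (∑ j, A i j * val (w T j) x) * val (z T i) x

/-- `v ∈ H^div(Ω)`: the distributional divergence of `v` on `Ω` is the square integrable function
given by the elementwise divergence. (If the distributional divergence is any `L²` function at all,
it is this one, as one sees from test functions supported in the interior of an element.) -/
def IsHdiv (M : Mesh d ι I B) (v : Vect d ι) : Prop :=
  ∀ φ : E d → ℝ, ContDiff ℝ (⊤ : ℕ∞) φ → HasCompactSupport φ → tsupport φ ⊆ M.domain →
    ∑ T, ∫ x in M.elem T, ∑ i, val (v T i) x * fderiv ℝ φ x (EuclideanSpace.single i 1) =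
      -∑ T, ∫ x in M.elem T, val (divB d ι v T) x * φ x

variable [Fintype I]

/-- The symmetric interior penalty form `d_h` for `-2 div ε(u)`, with Dirichlet faces `Γ`. -/
def dForm (M : Mesh d ι I B) (Γ : Finset B) (γ : ℝ) (u v : Vect d ι) : ℝ :=
  2 * (∑ T, ∫ x in M.elem T, ∑ i, ∑ j, strain (u T) i j x * strain (v T) i j x)
  + γ / M.size * (∑ F, faceInt (M.iface F) fun x => ∑ i, M.jump u F i x * M.jump v F i x)
  - 2 * (∑ F, faceInt (M.iface F) fun x => ∑ i, M.avgStrainN u F i x * M.jump v F i x)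
  - 2 * (∑ F, faceInt (M.iface F) fun x => ∑ i, M.avgStrainN v F i x * M.jump u F i x)
  + γ / M.size * (∑ F ∈ Γ, faceInt (M.bface F) fun x =>
      ∑ i, val (u (M.owner F) i) x * val (v (M.owner F) i) x)
  - 2 * (∑ F ∈ Γ, faceInt (M.bface F) fun x =>
      ∑ i, strainN (u (M.owner F)) (M.bnormal F) i x * val (v (M.owner F) i) x)
  - 2 * (∑ F ∈ Γ, faceInt (M.bface F) fun x =>
      ∑ i, strainN (v (M.owner F)) (M.bnormal F) i x * val (u (M.owner F) i) x)

/-- The square of the mesh dependent norm `‖v‖_{1,h}`. -/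
def normSq (M : Mesh d ι I B) (Γ : Finset B) (γ : ℝ) (v : Vect d ι) : ℝ :=
  (∑ T, ∫ x in M.elem T, ∑ i, ∑ j, grad (v T) i j x ^ 2)
  + (∑ F, γ / M.size * faceInt (M.iface F) fun x => ∑ i, M.jump v F i x ^ 2)
  + (∑ F ∈ Γ, γ / M.size * faceInt (M.bface F) fun x => ∑ i, val (v (M.owner F) i) x ^ 2)

/-- Coercivity of `d_h` on the space `V`, for the penalty parameter `γ`. -/
def Coercive (M : Mesh d ι I B) (Γ : Finset B) (γ : ℝ) (V : Submodule ℝ (Vect d ι)) : Prop :=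
  ∃ κ : ℝ, 0 < κ ∧ ∀ v ∈ V, κ * M.normSq Γ γ v ≤ M.dForm Γ γ v v

end Forms

/-- The piecewise polynomial vector fields whose normal component vanishes on the boundary
faces in `Γ`. -/
def normalZero (M : Mesh d ι I B) (Γ : Finset B) : Submodule ℝ (Vect d ι) where
  carrier := {v | ∀ F ∈ Γ, ∀ x ∈ M.bface F, ∑ i, val (v (M.owner F) i) x * M.bnormal F i = 0}
  zero_mem' := by
    intro F _ x _
    simp [val]
  add_mem' := by
    intro u v hu hv F hF x hx
    have h₁ := hu F hF x hx
    have h₂ := hv F hF x hx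
    simp only [val, Pi.add_apply, map_add, add_mul, Finset.sum_add_distrib] at h₁ h₂ ⊢
    rw [h₁, h₂, add_zero]
  smul_mem' := by
    intro c v hv F hF x hx
    have h := hv F hF x hx
    simp only [val, Pi.smul_apply, MvPolynomial.smul_eval, mul_assoc, ← Finset.mul_sum] at h ⊢
    rw [h, mul_zero]

end Mesh

/-! ### The discrete Biot system -/

/-- The coefficients of the Biot system: the Lamé parameters, the Biot-Willis constant, the
constrained specific storage coefficient and the permeability. -/
structure Coefficients (d : ℕ) where
  mu : ℝ
  lam : ℝ
  alpha : ℝ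
  cs : ℝ
  K : Matrix (Fin d) (Fin d) ℝ

namespace Mesh

variable {d : ℕ} {ι I B : Type*} [Fintype ι] [Fintype I]

/-- The form `a_h` of linear elasticity. -/
def aForm (M : Mesh d ι I B) (Γ : Finset B) (γ : ℝ) (c : Coefficients d) (u v : Vect d ι) : ℝ :=
  c.mu * M.dForm Γ γ u v + c.lam * M.innerS (divB d ι u) (divB d ι v)

/-- `(p, w, u)` solves the homogeneous system with parameter `σ` in `Q × W × V`. -/
structure IsHomogeneousSolution (M : Mesh d ι I B) (Γ : Finset B) (γ : ℝ) (c : Coefficients d)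
    (Q : Submodule ℝ (Scal d ι)) (W V : Submodule ℝ (Vect d ι)) (σ : ℝ)
    (p : Q) (w : W) (u : V) : Prop where
  mass : ∀ q ∈ Q, M.innerS (σ • (c.cs • (p : Scal d ι) + c.alpha • divB d ι u)) q
    + M.innerS (divB d ι w) q = 0
  darcy : ∀ z ∈ W, M.innerV c.K⁻¹ w z - M.innerS p (divB d ι z) = 0
  elasticity : ∀ v ∈ V, M.aForm Γ γ c u v - c.alpha * M.innerS p (divB d ι v) = 0

/-- `(p, w, u)` solves the semi-discrete scheme on `[0, ∞)` with values in `Q × W × V`; the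
time-dependent right hand sides of the three equations are linear functionals of the test
functions. Continuity of a curve in a finite dimensional space is expressed by that of all its
linear coordinates. -/
structure IsSemidiscreteSolution (M : Mesh d ι I B) (Γ : Finset B) (γ : ℝ) (c : Coefficients d)
    (Q : Submodule ℝ (Scal d ι)) (W V : Submodule ℝ (Vect d ι))
    (f : ℝ → Module.Dual ℝ Q) (g : ℝ → Module.Dual ℝ W) (r : ℝ → Module.Dual ℝ V)
    (p : ℝ → Q) (w : ℝ → W) (u : ℝ → V) : Prop where
  continuous_p : ∀ l : Module.Dual ℝ Q, ContinuousOn (fun t => l (p t)) (Set.Ici 0)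
  continuous_w : ∀ l : Module.Dual ℝ W, ContinuousOn (fun t => l (w t)) (Set.Ici 0)
  continuous_u : ∀ l : Module.Dual ℝ V, ContinuousOn (fun t => l (u t)) (Set.Ici 0)
  /-- `(∂ₜ (c_s p + α div u), q) + (div w, q) = f(q)` -/
  mass : ∀ t > 0, ∀ q : Q,
    HasDerivAt (fun s => M.innerS (c.cs • (p s : Scal d ι) + c.alpha • divB d ι (u s)) q)
      (f t q - M.innerS (divB d ι (w t)) q) t
  darcy : ∀ t > 0, ∀ z : W,
    M.innerV c.K⁻¹ (w t) z - M.innerS (p t) (divB d ι z) = g t z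
  elasticity : ∀ t > 0, ∀ v : V,
    M.aForm Γ γ c (u t) v - c.alpha * M.innerS (p t) (divB d ι v) = r t v

/-- Unique solvability of initial value problems for the semi-discrete scheme: for all right hand
sides (`f`, `g` continuous and `r` continuously differentiable in time) and all initial values that
are compatible with the elasticity equation at time zero, there is exactly one solution. -/
def IsWellPosed (M : Mesh d ι I B) (Γ : Finset B) (γ : ℝ) (c : Coefficients d)
    (Q : Submodule ℝ (Scal d ι)) (W V : Submodule ℝ (Vect d ι)) : Prop :=
  ∀ (f : ℝ → Module.Dual ℝ Q) (g : ℝ → Module.Dual ℝ W) (r : ℝ → Module.Dual ℝ V),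
    (∀ q, ContinuousOn (fun t => f t q) (Set.Ici 0)) →
    (∀ z, ContinuousOn (fun t => g t z) (Set.Ici 0)) →
    (∀ v, ContDiffOn ℝ 1 (fun t => r t v) (Set.Ici 0)) →
    ∀ (p₀ : Q) (u₀ : V),
      (∀ v : V, M.aForm Γ γ c u₀ v - c.alpha * M.innerS p₀ (divB d ι v) = r 0 v) →
      ∃ (p : ℝ → Q) (w : ℝ → W) (u : ℝ → V),
        (M.IsSemidiscreteSolution Γ γ c Q W V f g r p w u ∧ p 0 = p₀ ∧ u 0 = u₀) ∧
        ∀ (p' : ℝ → Q) (w' : ℝ → W) (u' : ℝ → V),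
          M.IsSemidiscreteSolution Γ γ c Q W V f g r p' w' u' → p' 0 = p₀ → u' 0 = u₀ →
          ∀ t ≥ 0, p' t = p t ∧ w' t = w t ∧ u' t = u t

end Mesh

end

end Biot

/-! All claims rest on positivity of forms on finite-dimensional spaces.

Coercivity: on a finite-dimensional space, a positive semidefinite form is bounded by a multiple of
another one if it vanishes wherever that one does (`IsSymmNonneg.exists_le_mul`). This yields two
inequalities. The discrete trace inequality bounds strains on faces by strains on elements. The
discrete Korn inequality bounds gradients by strains and jumps, and requires that a field without
strain and jumps be zero. On each element such a field is a rigid motion x ↦ b + S x with S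
antisymmetric, and a rigid motion that vanishes in codimension one is zero. Hence the field vanishes
next to a Dirichlet face, and vanishing propagates through interior faces. It reaches every element
(`Mesh.forall_of_face_closed`): distinct elements without a common interior face meet in codimension
at least two, and a generic segment avoids such sets. For large γ, Young's inequality absorbs the
consistency terms.

Homogeneous system: testing with the solution, the elasticity equation being weighted by σ, cancels
the coupling and leaves σ c_s (p, p) + σ a_h(u, u) + (K⁻¹ w, w) = 0. So w and u vanish, and Darcy's
equation makes p orthogonal to div W = Q, even if c_s = 0.

Evolution: only η = c_s p + α div u is differentiated. Elasticity expresses u through p, and η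
becomes an affine function of p whose linear part has the quadratic form c_s (p, p) + a_h(u_p, u_p),
where u_p is the displacement driven by p. This is definite if c_s > 0, and also if α ≠ 0 because
div V = Q. Hence p, w and u are affine functions of η, and η solves a linear differential equation
with constant coefficients (`System.exists_elimination`, `System.existsUnique_solution`). -/

namespace Biot

/-! ### Geometry of mesh elements -/

/-- A convex body: a compact convex set with nonempty interior. -/
structure IsBody {V : Type*} [NormedAddCommGroup V] [NormedSpace ℝ V] (T : Set V) : Prop where
  isCompact : IsCompact T
  convex : Convex ℝ T
  nonempty_interior : (interior T).Nonempty

theorem IsBody.subset_closure_interior {V : Type*} [NormedAddCommGroup V] [NormedSpace ℝ V]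
    {T : Set V} (hT : IsBody T) : T ⊆ closure (interior T) := by
  rw [hT.convex.closure_interior_eq_closure_of_nonempty_interior hT.nonempty_interior]
  exact subset_closure

theorem IsSimplex.isBody {d : ℕ} {T : Set (E d)} (hT : IsSimplex T) : IsBody T := by
  obtain ⟨p, hp, rfl⟩ := hT
  refine ⟨(Set.finite_range p).isCompact_convexHull ℝ, convex_convexHull ℝ _, ?_⟩
  rw [interior_convexHull_nonempty_iff_affineSpan_eq_top,
    hp.affineSpan_eq_top_iff_card_eq_finrank_add_one]
  simp

theorem IsParallelotope.isBody {d : ℕ} (hd : 2 ≤ d) {T : Set (E d)} (hT : IsParallelotope T) :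
    IsBody T := by
  obtain ⟨a, b, hb, rfl⟩ := hT
  have : Nonempty (Fin d) := ⟨⟨0, by omega⟩⟩
  let b' := basisOfLinearIndependentOfCardEqFinrank hb (by simp)
  have hb' : (b'.parallelepiped : Set (E d)) = parallelepiped b := by
    simp [b']
  refine ⟨?_, ?_, ?_⟩
  · rw [← hb']
    exact b'.parallelepiped.isCompact.image (by fun_prop)
  · exact (convex_parallelepiped b).translate a
  · have h : interior ((fun x => a + x) '' parallelepiped b)
        = (fun x => a + x) '' interior (parallelepiped b) :=
      ((Homeomorph.addLeft a).image_interior _).symm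
    rw [h, ← hb']
    exact b'.parallelepiped.interior_nonempty.image _

theorem Mesh.isBody {d : ℕ} (hd : 2 ≤ d) {ι I B : Type*} (M : Mesh d ι I B) (T : ι) :
    IsBody (M.elem T) :=
  (M.shape T).elim IsSimplex.isBody (IsParallelotope.isBody hd)

theorem IsFacet.isCompact {d : ℕ} {T F : Set (E d)} (hF : IsFacet T F) (hT : IsBody T) :
    IsCompact F := hF.2.1.isCompact hT.isCompact

theorem IsFacet.convex {d : ℕ} {T F : Set (E d)} (hF : IsFacet T F) (hT : IsBody T) :
    Convex ℝ F := hF.2.1.convex hT.convex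

/-- The part of a convex set that lies in its affine span, seen from one of its points. -/
theorem isBody_preimage_vectorSpan {d : ℕ} {F : Set (E d)} (hc : IsCompact F) (hF : Convex ℝ F)
    {x₀ : E d} (hx₀ : x₀ ∈ F) :
    IsBody ((fun w : vectorSpan ℝ F => x₀ + (w : E d)) ⁻¹' F) ∧
      (fun w : vectorSpan ℝ F => x₀ + (w : E d)) ''
        ((fun w : vectorSpan ℝ F => x₀ + (w : E d)) ⁻¹' F) = F := by
  set W := vectorSpan ℝ F with hW
  let φ : W →ᵃ[ℝ] E d := AffineMap.const ℝ W x₀ + W.subtype.toAffineMap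
  have hφ : (fun w : W => x₀ + (w : E d)) = φ := rfl
  have hiso : Isometry φ := by
    refine Isometry.of_dist_eq fun x y => ?_
    simp [φ, Subtype.dist_eq]
  have himg : φ '' (φ ⁻¹' F) = F := by
    rw [Set.image_preimage_eq_iff]
    intro x hx
    exact ⟨⟨x - x₀, vsub_mem_vectorSpan ℝ hx hx₀⟩, by simp [φ]⟩
  rw [hφ]
  have hconv : Convex ℝ (φ ⁻¹' F) := hF.affine_preimage φ
  refine ⟨⟨?_, hconv, ?_⟩, himg⟩
  · exact hiso.isClosedEmbedding.isCompact_preimage hc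
  · rw [hconv.interior_nonempty_iff_affineSpan_eq_top,
      AffineSubspace.affineSpan_eq_top_iff_vectorSpan_eq_top_of_nonempty]
    · have h := AffineMap.map_vectorSpan φ (s := φ ⁻¹' F)
      have hlin : φ.linear = W.subtype := by
        ext x
        simp [φ]
      rw [himg, hlin] at h
      apply Submodule.map_injective_of_injective W.injective_subtype
      rw [h, Submodule.map_top, Submodule.range_subtype]
    · exact ⟨0, by simpa [φ] using hx₀⟩

/-- A convex set has interior points relative to its affine span. Applied to a face, this allows
motion in every tangential direction. -/
theorem exists_relative_ball {d : ℕ} {F : Set (E d)} (hc : IsCompact F) (hF : Convex ℝ F)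
    (hne : F.Nonempty) :
    ∃ x₀ ∈ F, ∃ ε > 0, ∀ w ∈ vectorSpan ℝ F, ‖w‖ < ε → x₀ + w ∈ F := by
  obtain ⟨x₁, hx₁⟩ := hne
  obtain ⟨hb, -⟩ := isBody_preimage_vectorSpan hc hF hx₁
  obtain ⟨w₀, hw₀⟩ := hb.nonempty_interior
  obtain ⟨ε, hε, hball⟩ := Metric.isOpen_iff.1 isOpen_interior w₀ hw₀
  refine ⟨x₁ + w₀, (interior_subset hw₀ : w₀ ∈ _ ⁻¹' F), ε, hε, fun w hw hwε => ?_⟩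
  have : w₀ + ⟨w, hw⟩ ∈ Metric.ball w₀ ε := by
    simpa [Metric.mem_ball, dist_eq_norm] using hwε
  have h := interior_subset (hball this)
  simpa [add_assoc] using h

/-- An exposed face that spans the whole space is not proper. -/
theorem IsExposed.eq_of_vectorSpan_eq_top {d : ℕ} {T F : Set (E d)} (h : IsExposed ℝ T F)
    (hne : F.Nonempty) (htop : vectorSpan ℝ F = ⊤) : F = T := by
  obtain ⟨l, hl⟩ := h hne
  -- The exposing functional is constant on `F`, so it annihilates all directions of `F` and is
  -- zero; every point of `T` then maximises it.
  have hker : vectorSpan ℝ F ≤ LinearMap.ker (l : E d →ₗ[ℝ] ℝ) := by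
    rw [vectorSpan_def, Submodule.span_le]
    rintro _ ⟨x, hx, y, hy, rfl⟩
    rw [hl] at hx hy
    have h₁ := hx.2 y hy.1
    have h₂ := hy.2 x hx.1
    simp only [vsub_eq_sub, SetLike.mem_coe, LinearMap.mem_ker, map_sub,
      ContinuousLinearMap.coe_coe]
    linarith
  have hl0 : ∀ x, l x = 0 := fun x => by
    have : x ∈ vectorSpan ℝ F := htop ▸ Submodule.mem_top
    exact hker this
  rw [hl]
  ext x
  simp [hl0]

/-! ### Incidence of elements and faces -/

namespace Mesh

variable {d : ℕ} {ι I B : Type*}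

theorem eq_of_vectorSpan_inter_eq_top (M : Mesh d ι I B) {T S : ι}
    (hne : (M.elem T ∩ M.elem S).Nonempty) (htop : vectorSpan ℝ (M.elem T ∩ M.elem S) = ⊤) :
    T = S := by
  have h₁ := IsExposed.eq_of_vectorSpan_eq_top (M.conforming T S) hne htop
  have h₂ := IsExposed.eq_of_vectorSpan_eq_top (M.conforming S T) (Set.inter_comm _ _ ▸ hne)
    (Set.inter_comm _ _ ▸ htop)
  exact M.elem_injective (h₁.symm.trans ((Set.inter_comm _ _).trans h₂))

/-- Two mesh elements that share a face and have points on the same side of it coincide. -/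
theorem eq_of_same_side (M : Mesh d ι I B) (hd : 2 ≤ d) {T S : ι} {W : Submodule ℝ (E d)}
    {n x₀ : E d} (hWn : ∀ x, ∃ w ∈ W, ∃ s : ℝ, x = w + s • n ∧ s = inner ℝ n x)
    {ε : ℝ} (hε : 0 < ε) (hT : ∀ w ∈ W, ‖w‖ < ε → x₀ + w ∈ M.elem T)
    (hS : ∀ w ∈ W, ‖w‖ < ε → x₀ + w ∈ M.elem S)
    {y z : E d} (hy : y ∈ M.elem T) (hz : z ∈ M.elem S)
    (hyn : 0 < inner ℝ n (y - x₀)) (hzn : 0 < inner ℝ n (z - x₀)) : T = S := by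
  -- Write y = x₀ + w + s • n. Then x₀ + δ • n is the convex combination, with weights δ/s and 1 -
  -- δ/s, of y and a point x₀ - τ • w. Here τ tends to 0 with δ, so this point stays in the
  -- tangential ball.
  have key : ∀ (R : ι) (y : E d), y ∈ M.elem R → (∀ w ∈ W, ‖w‖ < ε → x₀ + w ∈ M.elem R) →
      0 < inner ℝ n (y - x₀) → ∀ᶠ δ in nhdsWithin (0 : ℝ) (Set.Ioi 0), x₀ + δ • n ∈ M.elem R := by
    intro R y hy hR hyn
    obtain ⟨w, hw, s, hws, hs⟩ := hWn (y - x₀)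
    rw [← hs] at hyn
    have hlim : Filter.Tendsto (fun δ : ℝ => ‖(-(δ / s / (1 - δ / s))) • w‖)
        (nhdsWithin (0 : ℝ) (Set.Ioi 0)) (nhds 0) := by
      have : ContinuousAt (fun δ : ℝ => ‖(-(δ / s / (1 - δ / s))) • w‖) 0 := by
        have h1 : (1 - (0 : ℝ) / s) ≠ 0 := by simp
        fun_prop (disch := assumption)
      have h := this.tendsto
      simp only [zero_div, neg_zero, zero_smul, norm_zero] at h
      exact h.mono_left nhdsWithin_le_nhds
    have hsm : ∀ᶠ δ in nhdsWithin (0 : ℝ) (Set.Ioi 0), δ < s :=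
      (eventually_lt_nhds hyn).filter_mono nhdsWithin_le_nhds
    filter_upwards [hlim.eventually_lt_const hε, hsm, self_mem_nhdsWithin] with δ h1 h2 h3
    have h3' : 0 < δ := h3
    have hτ : δ / s < 1 := (div_lt_one hyn).2 h2
    have hmem := hR _ (W.smul_mem _ hw) h1
    have := (M.isBody hd R).convex hmem hy (a := 1 - δ / s) (b := δ / s) (by linarith)
      (by positivity) (by ring)
    convert this using 1
    have hyx : y = x₀ + (w + s • n) := by rw [← hws]; abel
    have hne : 1 - δ / s ≠ 0 := by linarith
    rw [hyx, smul_add, smul_smul, smul_add, smul_add, smul_smul]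
    have e1 : (1 - δ / s) * -(δ / s / (1 - δ / s)) = -(δ / s) := by
      rw [mul_neg, mul_div_cancel₀ _ hne]
    have e2 : δ / s * s = δ := by field_simp
    rw [e1, e2]
    module
  obtain ⟨δ, ⟨hδT, hδS⟩, hδ⟩ := (((key T y hy hT hyn).and (key S z hz hS hzn)).and
    self_mem_nhdsWithin).exists
  have hx₀ : x₀ ∈ M.elem T ∩ M.elem S :=
    ⟨by simpa using hT 0 W.zero_mem (by simpa using hε),
      by simpa using hS 0 W.zero_mem (by simpa using hε)⟩
  -- The intersection contains a tangential ball about x₀ and a point x₀ + δ • n, so its directions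
  -- span the whole space.
  refine M.eq_of_vectorSpan_inter_eq_top ⟨x₀, hx₀⟩ (eq_top_iff.2 fun x _ => ?_)
  obtain ⟨w, hw, s, hws, -⟩ := hWn x
  rw [hws]
  refine Submodule.add_mem _ ?_ ?_
  · obtain ⟨c, hc, hcw⟩ : ∃ c : ℝ, 0 < c ∧ ‖c • w‖ < ε := by
      refine ⟨ε / (2 * (‖w‖ + 1)), by positivity, ?_⟩
      rw [norm_smul, Real.norm_of_nonneg (by positivity), div_mul_eq_mul_div,
        div_lt_iff₀ (by positivity)]
      nlinarith [norm_nonneg w]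
    have hm : x₀ + c • w ∈ M.elem T ∩ M.elem S :=
      ⟨hT _ (W.smul_mem c hw) hcw, hS _ (W.smul_mem c hw) hcw⟩
    have h := vsub_mem_vectorSpan ℝ hm hx₀
    have h' := Submodule.smul_mem _ c⁻¹ h
    rwa [vsub_eq_sub, add_sub_cancel_left, inv_smul_smul₀ hc.ne'] at h'
  · have hm : x₀ + δ • n ∈ M.elem T ∩ M.elem S := ⟨hδT, hδS⟩
    have h := vsub_mem_vectorSpan ℝ hm hx₀
    have h' := Submodule.smul_mem _ (s * δ⁻¹) h
    have hδ' : δ ≠ 0 := (show 0 < δ from hδ).ne'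
    rwa [vsub_eq_sub, add_sub_cancel_left, smul_smul, mul_assoc, inv_mul_cancel₀ hδ',
      mul_one] at h'

/-- The orthogonal complement is a line; n is a normalised generator. The sign of s tells on which
side of `W` a vector lies. -/
theorem exists_unit_normal {W : Submodule ℝ (E d)}
    (hW : Module.finrank ℝ W + 1 = d) : ∃ n : E d, ‖n‖ = 1 ∧
      ∀ x, ∃ w ∈ W, ∃ s : ℝ, x = w + s • n ∧ s = inner ℝ n x := by
  have h1 : Module.finrank ℝ Wᗮ = 1 := by
    have := Submodule.finrank_add_finrank_orthogonal W
    simp only [finrank_euclideanSpace, Fintype.card_fin] at this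
    omega
  obtain ⟨m, hm0, hm⟩ := finrank_eq_one_iff'.1 h1
  have hm0' : (m : E d) ≠ 0 := by simpa using hm0
  have hunit : ‖(‖(m : E d)‖⁻¹ • (m : E d))‖ = 1 := norm_smul_inv_norm (𝕜 := ℝ) hm0'
  have hperp : ‖(m : E d)‖⁻¹ • (m : E d) ∈ Wᗮ := Submodule.smul_mem _ _ m.2
  set n := ‖(m : E d)‖⁻¹ • (m : E d) with hn
  refine ⟨n, hunit, fun x => ?_⟩
  obtain ⟨w, hw, z, hz, rfl⟩ := W.exists_add_mem_mem_orthogonal x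
  obtain ⟨c, hc⟩ := hm ⟨z, hz⟩
  have hzc : z = (c * ‖(m : E d)‖) • n := by
    have := congrArg (Subtype.val) hc
    simp only [Submodule.coe_smul] at this
    rw [hn, smul_smul, mul_assoc, mul_inv_cancel₀ (norm_ne_zero_iff.2 hm0'), mul_one, this]
  refine ⟨w, hw, c * ‖(m : E d)‖, by rw [hzc], ?_⟩
  rw [inner_add_right, hzc, inner_smul_right, real_inner_self_eq_norm_sq, hunit,
    Submodule.inner_left_of_mem_orthogonal hw hperp]
  ring

/-- A face belongs to at most two elements. -/
theorem eq_or_eq_of_isFacet (M : Mesh d ι I B) (hd : 2 ≤ d) {F : Set (E d)} {T S R : ι}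
    (hTS : T ≠ S) (hT : IsFacet (M.elem T) F) (hS : IsFacet (M.elem S) F)
    (hR : IsFacet (M.elem R) F) : R = T ∨ R = S := by
  obtain ⟨x₀, hx₀, ε, hε, hball⟩ := exists_relative_ball (hT.isCompact (M.isBody hd T))
    (hT.convex (M.isBody hd T)) hT.1
  obtain ⟨n, hn, hdec⟩ := exists_unit_normal hT.2.2
  have hdec' : ∀ x, ∃ w ∈ vectorSpan ℝ F, ∃ s : ℝ, x = w + s • (-n) ∧ s = inner ℝ (-n) x := by
    intro x
    obtain ⟨w, hw, s, h1, h2⟩ := hdec x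
    exact ⟨w, hw, -s, by simpa using h1, by simp [h2]⟩
  have hin : ∀ P : ι, IsFacet (M.elem P) F → ∀ w ∈ vectorSpan ℝ F, ‖w‖ < ε →
      x₀ + w ∈ M.elem P := fun P hP w hw hwε => hP.2.1.subset (hball w hw hwε)
  -- Otherwise the element would lie in a hyperplane, although it has interior points.
  have hside : ∀ P : ι, (∃ y ∈ M.elem P, 0 < inner ℝ n (y - x₀)) ∨
      ∃ y ∈ M.elem P, 0 < inner ℝ (-n) (y - x₀) := by
    intro P
    by_contra! hcon
    have hzero : ∀ y ∈ M.elem P, inner ℝ n (y - x₀) = (0 : ℝ) := fun y hy => by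
      have h1 := hcon.1 y hy
      have h2 := hcon.2 y hy
      rw [inner_neg_left] at h2
      linarith
    obtain ⟨y, hy⟩ := (M.isBody hd P).nonempty_interior
    obtain ⟨r, hr, hyr⟩ := Metric.isOpen_iff.1 isOpen_interior y hy
    have hmem : y + (r / 2) • n ∈ M.elem P := by
      refine interior_subset (hyr ?_)
      rw [Metric.mem_ball, dist_eq_norm, add_sub_cancel_left, norm_smul, hn, mul_one,
        Real.norm_of_nonneg (by positivity)]
      linarith
    have h1 := hzero _ hmem
    have h2 := hzero y (interior_subset hy)
    rw [add_sub_right_comm, inner_add_right, h2, inner_smul_right, real_inner_self_eq_norm_sq,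
      hn] at h1
    norm_num at h1
    exact hr.ne' h1
  have hpos : ∀ P P' : ι, IsFacet (M.elem P) F → IsFacet (M.elem P') F →
      (∃ y ∈ M.elem P, 0 < inner ℝ n (y - x₀)) → (∃ y ∈ M.elem P', 0 < inner ℝ n (y - x₀)) →
      P = P' := by
    rintro P P' hP hP' ⟨y, hy, hyn⟩ ⟨z, hz, hzn⟩
    exact M.eq_of_same_side hd hdec hε (hin P hP) (hin P' hP') hy hz hyn hzn
  have hneg : ∀ P P' : ι, IsFacet (M.elem P) F → IsFacet (M.elem P') F →
      (∃ y ∈ M.elem P, 0 < inner ℝ (-n) (y - x₀)) →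
      (∃ y ∈ M.elem P', 0 < inner ℝ (-n) (y - x₀)) → P = P' := by
    rintro P P' hP hP' ⟨y, hy, hyn⟩ ⟨z, hz, hzn⟩
    exact M.eq_of_same_side hd hdec' hε (hin P hP) (hin P' hP') hy hz hyn hzn
  -- Three elements share two sides, and elements on the same side coincide.
  rcases hside T with h1 | h1 <;> rcases hside S with h2 | h2 <;> rcases hside R with h3 | h3
  · exact absurd (hpos T S hT hS h1 h2) hTS
  · exact absurd (hpos T S hT hS h1 h2) hTS
  · exact Or.inl (hpos R T hR hT h3 h1)
  · exact Or.inr (hneg R S hR hS h3 h2)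
  · exact Or.inr (hpos R S hR hS h3 h2)
  · exact Or.inl (hneg R T hR hT h3 h1)
  · exact absurd (hneg T S hT hS h1 h2) hTS
  · exact absurd (hneg T S hT hS h1 h2) hTS

/-- Distinct elements that do not share an interior face meet in a set of codimension at
least two. -/
theorem finrank_vectorSpan_inter (M : Mesh d ι I B) {T S : ι} (hTS : T ≠ S)
    (hF : ∀ F, ¬ (IsFacet (M.elem T) (M.iface F) ∧ IsFacet (M.elem S) (M.iface F)))
    (hne : (M.elem T ∩ M.elem S).Nonempty) :
    Module.finrank ℝ (vectorSpan ℝ (M.elem T ∩ M.elem S)) + 2 ≤ d := by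
  have hle : Module.finrank ℝ (vectorSpan ℝ (M.elem T ∩ M.elem S)) ≤ d := by
    simpa using Submodule.finrank_le (vectorSpan ℝ (M.elem T ∩ M.elem S))
  have h1 : Module.finrank ℝ (vectorSpan ℝ (M.elem T ∩ M.elem S)) ≠ d := fun h =>
    hTS (M.eq_of_vectorSpan_inter_eq_top hne (Submodule.eq_top_of_finrank_eq (by simpa using h)))
  -- In codimension one the intersection would be a common facet, hence one of the interior faces.
  have h2 : Module.finrank ℝ (vectorSpan ℝ (M.elem T ∩ M.elem S)) + 1 ≠ d := by
    intro h
    have hT : IsFacet (M.elem T) (M.elem T ∩ M.elem S) := ⟨hne, M.conforming T S, h⟩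
    have hS : IsFacet (M.elem S) (M.elem T ∩ M.elem S) :=
      ⟨hne, Set.inter_comm (M.elem S) _ ▸ M.conforming S T, h⟩
    have hmem : M.elem T ∩ M.elem S ∈ Set.range M.iface := by
      rw [M.range_iface]
      exact ⟨T, S, hTS, hT, hS⟩
    obtain ⟨F, hF'⟩ := hmem
    exact hF F (hF' ▸ ⟨hT, hS⟩)
  omega

end Mesh

/-- A point from which the segment to `a` meets `P` lies in the affine span of `a` and `P`. -/
theorem mem_affineSpan_insert_of_segment {d : ℕ} {P : Set (E d)} {a c z : E d} (ha : a ∉ P)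
    (hz : z ∈ P) (hzs : z ∈ segment ℝ a c) : c ∈ affineSpan ℝ (insert a P) := by
  rw [segment_eq_image_lineMap] at hzs
  obtain ⟨t, -, rfl⟩ := hzs
  have ht : t ≠ 0 := by
    rintro rfl
    simp at hz
    exact ha hz
  have h1 : a ∈ affineSpan ℝ (insert a P) := mem_affineSpan ℝ (Set.mem_insert _ _)
  have h2 : AffineMap.lineMap a c t ∈ affineSpan ℝ (insert a P) :=
    mem_affineSpan ℝ (Set.mem_insert_of_mem _ hz)
  have h3 := AffineMap.lineMap_mem t⁻¹ h1 h2
  rwa [AffineMap.lineMap_lineMap_right, inv_mul_cancel₀ ht, AffineMap.lineMap_apply_one] at h3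

open MeasureTheory in
theorem volume_affineSpan_eq_zero {d : ℕ} {P : Set (E d)}
    (hP : Module.finrank ℝ (vectorSpan ℝ P) < d) :
    volume (affineSpan ℝ P : Set (E d)) = 0 := by
  refine Measure.addHaar_affineSubspace _ _ fun h => ?_
  have : (affineSpan ℝ P).direction = ⊤ := by rw [h]; simp
  rw [direction_affineSpan] at this
  rw [this] at hP
  simp at hP

open MeasureTheory in
theorem exists_mem_notMem_of_volume_eq_zero {d : ℕ} {U N : Set (E d)} (hU : IsOpen U)
    (hne : U.Nonempty) (hN : volume N = 0) : ∃ x ∈ U, x ∉ N := by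
  by_contra! h
  exact (hU.measure_pos volume hne).ne' (measure_mono_null h hN)

/-! ### Connectivity of the mesh through interior faces -/

namespace Mesh

variable {d : ℕ} {ι I B : Type*}

open MeasureTheory in
/-- The elements of a mesh of a connected domain are connected through interior faces. -/
theorem forall_of_face_closed [Finite ι] (M : Mesh d ι I B) (hd : 2 ≤ d)
    (hΩ : IsConnected M.domain) (A : Set ι) (hA : A.Nonempty)
    (hclosed : ∀ F, M.minus F ∈ A ↔ M.plus F ∈ A) : ∀ T, T ∈ A := by
  classical
  by_contra! hcon
  obtain ⟨T₁, hT₁⟩ := hcon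
  obtain ⟨T₀, hT₀⟩ := hA
  have hincl : ∀ T, interior (M.elem T) ⊆ M.domain := fun T =>
    interior_mono (Set.subset_iUnion M.elem T)
  have hcl : ∀ C : Set ι, IsClosed (⋃ T ∈ C, M.elem T) := fun C =>
    (Set.toFinite C).isClosed_biUnion fun T _ => (M.isBody hd T).isCompact.isClosed
  have hcov : M.domain ⊆ (⋃ T ∈ A, M.elem T) ∪ ⋃ T ∈ Aᶜ, M.elem T := by
    intro x hx
    obtain ⟨T, hT⟩ := Set.mem_iUnion.1 (interior_subset hx)
    by_cases h : T ∈ A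
    · exact Or.inl (Set.mem_biUnion h hT)
    · exact Or.inr (Set.mem_biUnion h hT)
  have hmeet : ∀ C : Set ι, ∀ T ∈ C, (M.domain ∩ ⋃ T ∈ C, M.elem T).Nonempty := by
    intro C T hT
    obtain ⟨x, hx⟩ := (M.isBody hd T).nonempty_interior
    exact ⟨x, hincl T hx, Set.mem_biUnion hT (interior_subset hx)⟩
  -- The elements in `A` and those outside have closed unions that cover the connected domain, so
  -- the two unions meet inside it.
  obtain ⟨x₀, hx₀, hxA, hxC⟩ := isPreconnected_closed_iff.1 hΩ.isPreconnected _ _ (hcl A) (hcl Aᶜ)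
    hcov (hmeet A T₀ hT₀) (hmeet Aᶜ T₁ hT₁)
  obtain ⟨r, hr, hball⟩ := Metric.isOpen_iff.1 (isOpen_interior : IsOpen M.domain) x₀ hx₀
  have hcodim : ∀ T ∈ A, ∀ S ∈ Aᶜ, (M.elem T ∩ M.elem S).Nonempty →
      Module.finrank ℝ (vectorSpan ℝ (M.elem T ∩ M.elem S)) + 2 ≤ d := by
    intro T hT S hS hne
    have hTS : T ≠ S := fun h => hS (h ▸ hT)
    refine M.finrank_vectorSpan_inter hTS (fun F hF => ?_) hne
    have h1 := M.eq_or_eq_of_isFacet hd (M.minus_ne_plus F) (M.facet_minus F) (M.facet_plus F) hF.1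
    have h2 := M.eq_or_eq_of_isFacet hd (M.minus_ne_plus F) (M.facet_minus F) (M.facet_plus F) hF.2
    have h3 := hclosed F
    rcases h1 with rfl | rfl <;> rcases h2 with rfl | rfl
    · exact hTS rfl
    · exact hS (h3.1 hT)
    · exact hS (h3.2 hT)
    · exact hTS rfl
  have hopen : ∀ C : Set ι, x₀ ∈ ⋃ T ∈ C, M.elem T → ∃ T ∈ C,
      (interior (M.elem T) ∩ Metric.ball x₀ r).Nonempty := by
    intro C hx
    obtain ⟨T, hT, hxT⟩ := Set.mem_iUnion₂.1 hx
    refine ⟨T, hT, ?_⟩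
    have := mem_closure_iff.1 ((M.isBody hd T).subset_closure_interior hxT) _
      Metric.isOpen_ball (Metric.mem_ball_self hr)
    rwa [Set.inter_comm]
  obtain ⟨T, hT, hTne⟩ := hopen A hxA
  obtain ⟨S, hS, hSne⟩ := hopen Aᶜ hxC
  obtain ⟨a, ⟨haT, har⟩, haN⟩ := exists_mem_notMem_of_volume_eq_zero
    (isOpen_interior.inter Metric.isOpen_ball) hTne
    (N := ⋃ q : {q : ι × ι // q.1 ∈ A ∧ q.2 ∈ Aᶜ ∧ (M.elem q.1 ∩ M.elem q.2).Nonempty},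
      (affineSpan ℝ (M.elem q.1.1 ∩ M.elem q.1.2) : Set (E d)))
    (measure_iUnion_null fun q => volume_affineSpan_eq_zero (by
      have := hcodim _ q.2.1 _ q.2.2.1 q.2.2.2
      omega))
  -- Adjoining `a` raises the dimension by at most one, so codimension two is what keeps these spans
  -- null sets.
  obtain ⟨c, ⟨hcS, hcr⟩, hcN⟩ := exists_mem_notMem_of_volume_eq_zero
    (isOpen_interior.inter Metric.isOpen_ball) hSne
    (N := ⋃ q : {q : ι × ι // q.1 ∈ A ∧ q.2 ∈ Aᶜ ∧ (M.elem q.1 ∩ M.elem q.2).Nonempty},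
      (affineSpan ℝ (insert a (M.elem q.1.1 ∩ M.elem q.1.2)) : Set (E d)))
    (measure_iUnion_null fun q => volume_affineSpan_eq_zero (by
      have h1 := hcodim _ q.2.1 _ q.2.2.1 q.2.2.2
      have h2 := finrank_vectorSpan_insert_le_set ℝ (M.elem q.1.1 ∩ M.elem q.1.2) a
      omega))
  have hseg : segment ℝ a c ⊆ M.domain :=
    ((convex_ball x₀ r).segment_subset har hcr).trans hball
  -- The segment passes from one class to the other at a point z of some intersection; this puts c
  -- in the affine span of a and that intersection, against its choice.
  obtain ⟨z, hz, hzA, hzC⟩ := isPreconnected_closed_iff.1 (convex_segment a c).isPreconnected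
    _ _ (hcl A) (hcl Aᶜ) (hseg.trans hcov)
    ⟨a, left_mem_segment ℝ a c, Set.mem_biUnion hT (interior_subset haT)⟩
    ⟨c, right_mem_segment ℝ a c, Set.mem_biUnion hS (interior_subset hcS)⟩
  obtain ⟨T', hT', hzT⟩ := Set.mem_iUnion₂.1 hzA
  obtain ⟨S', hS', hzS⟩ := Set.mem_iUnion₂.1 hzC
  have hq : (M.elem T' ∩ M.elem S').Nonempty := ⟨z, hzT, hzS⟩
  refine hcN (Set.mem_iUnion.2 ⟨⟨(T', S'), hT', hS', hq⟩, ?_⟩)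
  refine mem_affineSpan_insert_of_segment (fun ha => haN ?_)
    (⟨hzT, hzS⟩ : z ∈ M.elem T' ∩ M.elem S') hz
  exact Set.mem_iUnion.2 ⟨⟨(T', S'), hT', hS', hq⟩, mem_affineSpan ℝ ha⟩

/-- Makes the weight γ / h positive; with h = 0 it would be 0 by the convention for division. -/
theorem size_pos [Finite ι] (M : Mesh d ι I B) (hd : 2 ≤ d) (T : ι) : 0 < M.size := by
  have hb := M.isBody hd T
  have hnt : (M.elem T).Nontrivial := by
    obtain ⟨x, hx⟩ := hb.nonempty_interior
    obtain ⟨r, hr, hxr⟩ := Metric.isOpen_iff.1 isOpen_interior x hx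
    have hne : (EuclideanSpace.single ⟨0, by omega⟩ (1 : ℝ) : E d) ≠ 0 := by simp
    refine ⟨x, interior_subset hx, x + (r / 2) • EuclideanSpace.single ⟨0, by omega⟩ (1 : ℝ),
      interior_subset (hxr ?_), ?_⟩
    · rw [Metric.mem_ball, dist_eq_norm, add_sub_cancel_left, norm_smul,
        Real.norm_of_nonneg (by positivity)]
      simp
      linarith
    · intro h
      have := left_eq_add.1 h
      rcases smul_eq_zero.1 this with h | h
      · linarith
      · exact hne h
  have hpos := Metric.diam_pos hnt hb.isCompact.isBounded
  exact hpos.trans_le (le_ciSup (f := fun T => Metric.diam (M.elem T))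
    (Set.finite_range _).bddAbove T)

end Mesh

end Biot

namespace Biot

open MeasureTheory

/-! ### Integrals of polynomials -/

section Val

variable {d : ℕ}

theorem continuous_val (f : MvPolynomial (Fin d) ℝ) : Continuous (val f) :=
  (MvPolynomial.continuous_eval f).comp (by fun_prop)

@[simp] theorem val_add (f g : MvPolynomial (Fin d) ℝ) (x : E d) :
    val (f + g) x = val f x + val g x := by simp [val]

@[simp] theorem val_sub (f g : MvPolynomial (Fin d) ℝ) (x : E d) :
    val (f - g) x = val f x - val g x := by simp [val]

@[simp] theorem val_mul (f g : MvPolynomial (Fin d) ℝ) (x : E d) :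
    val (f * g) x = val f x * val g x := by simp [val]

@[simp] theorem val_smul (c : ℝ) (f : MvPolynomial (Fin d) ℝ) (x : E d) :
    val (c • f) x = c * val f x := by simp [val]

@[simp] theorem val_sum {α : Type*} (s : Finset α) (f : α → MvPolynomial (Fin d) ℝ) (x : E d) :
    val (∑ i ∈ s, f i) x = ∑ i ∈ s, val (f i) x := by simp [val]

/-- A polynomial that vanishes on a set with nonempty interior is zero. -/
theorem eq_zero_of_val_eq_zero {T : Set (E d)} (hT : (interior T).Nonempty)
    {f : MvPolynomial (Fin d) ℝ} (hf : ∀ x ∈ T, val f x = 0) : f = 0 := by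
  obtain ⟨x, hx⟩ := hT
  have hopen : IsOpen ((WithLp.toLp 2 : (Fin d → ℝ) → E d) ⁻¹' interior T) :=
    isOpen_interior.preimage (PiLp.continuous_toLp 2 _)
  obtain ⟨r, hr, hball⟩ := Metric.isOpen_iff.1 hopen (WithLp.ofLp x) (by simpa using hx)
  -- A sup-norm ball is a box, so the polynomial vanishes on a product of infinite sets.
  refine MvPolynomial.funext_set (fun i => Metric.ball (x i) r) (fun i => ?_) fun y hy => ?_
  · rw [Real.ball_eq_Ioo]
    exact Set.Ioo_infinite (by linarith)
  · have hy' : y ∈ Metric.ball (WithLp.ofLp x) r := by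
      rw [Metric.mem_ball, dist_pi_lt_iff hr]
      exact fun i => hy i (Set.mem_univ i)
    have := hf _ (interior_subset (hball hy'))
    simpa [val] using this

end Val

/-! ### Measures that detect nonzero polynomials -/

/-- A compact set of finite measure all of whose nonempty relatively open subsets have positive
measure. -/
structure IsThick {d : ℕ} (μ : Measure (E d)) (K : Set (E d)) : Prop where
  isCompact : IsCompact K
  measure_lt_top : μ K < ⊤
  measure_pos : ∀ U, IsOpen U → (K ∩ U).Nonempty → 0 < μ (K ∩ U)

namespace IsThick

variable {d : ℕ} {μ : Measure (E d)} {K : Set (E d)}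

theorem integrableOn (h : IsThick μ K) {f : E d → ℝ} (hf : Continuous f) :
    IntegrableOn f K μ := by
  obtain ⟨C, hC⟩ := h.isCompact.exists_bound_of_continuousOn hf.continuousOn
  exact IntegrableOn.of_bound h.measure_lt_top hf.aestronglyMeasurable C
    ((ae_restrict_iff' h.isCompact.measurableSet).2 (Filter.Eventually.of_forall hC))

/-- Integration of polynomials over `K`. -/
noncomputable def integral (h : IsThick μ K) : MvPolynomial (Fin d) ℝ →ₗ[ℝ] ℝ where
  toFun f := ∫ x in K, val f x ∂μ
  map_add' f g := by
    simp only [val_add]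
    exact integral_add (h.integrableOn (continuous_val f)) (h.integrableOn (continuous_val g))
  map_smul' c f := by
    simp only [val_smul]
    exact integral_const_mul c _

theorem integral_apply (h : IsThick μ K) (f : MvPolynomial (Fin d) ℝ) :
    h.integral f = ∫ x in K, val f x ∂μ := rfl

theorem integral_nonneg (h : IsThick μ K) {f : MvPolynomial (Fin d) ℝ} (hf : ∀ x, 0 ≤ val f x) :
    0 ≤ h.integral f := MeasureTheory.integral_nonneg hf

/-- The points of `K` where f does not vanish form a relatively open null set, which must be empty.
-/
theorem val_eq_zero_of_integral_eq_zero (h : IsThick μ K) {f : MvPolynomial (Fin d) ℝ}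
    (hf : ∀ x, 0 ≤ val f x) (hf0 : h.integral f = 0) : ∀ x ∈ K, val f x = 0 := by
  rw [integral_apply, setIntegral_eq_zero_iff_of_nonneg_ae (Filter.Eventually.of_forall hf)
    (h.integrableOn (continuous_val f)), Filter.EventuallyEq,
    ae_restrict_iff' h.isCompact.measurableSet, ae_iff] at hf0
  intro x hx
  by_contra hne
  have hpos := h.measure_pos {y | val f y ≠ 0}
    (isOpen_ne_fun (continuous_val f) continuous_const) ⟨x, hx, hne⟩
  refine hpos.ne' (measure_mono_null ?_ hf0)
  rintro y ⟨hy, hy'⟩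
  simpa using ⟨hy, hy'⟩

end IsThick

/-- A body lies in the closure of its interior, so each nonempty relatively open part contains a
nonempty open set. -/
theorem IsBody.isThick {d : ℕ} {T : Set (E d)} (hT : IsBody T) : IsThick volume T := by
  refine ⟨hT.isCompact, hT.isCompact.measure_lt_top, fun U hU ⟨x, hx, hxU⟩ => ?_⟩
  have hne := mem_closure_iff.1 (hT.subset_closure_interior hx) U hU hxU
  exact ((hU.inter isOpen_interior).measure_pos volume hne).trans_le
    (measure_mono fun y hy => ⟨interior_subset hy.2, hy.1⟩)

/-- The surface measure on a face. -/
theorem IsFacet.isThick {d : ℕ} {T F : Set (E d)} (hF : IsFacet T F) (hT : IsBody T) :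
    IsThick (Measure.euclideanHausdorffMeasure (d - 1)) F := by
  obtain ⟨x₀, hx₀⟩ := hF.1
  have hdim : d - 1 = Module.finrank ℝ (vectorSpan ℝ F) := by
    have := hF.2.2
    omega
  -- The face is the isometric image of a body in its own vector span, where the Hausdorff measure
  -- of that dimension is finite on compact sets and positive on nonempty open sets.
  obtain ⟨hb, himg⟩ := isBody_preimage_vectorSpan (hF.isCompact hT) (hF.convex hT) hx₀
  set φ : vectorSpan ℝ F → E d := fun w => x₀ + (w : E d) with hφ
  have hiso : Isometry φ := by
    refine Isometry.of_dist_eq fun x y => ?_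
    simp [φ, Subtype.dist_eq]
  rw [hdim]
  refine ⟨hF.isCompact hT, ?_, fun U hU ⟨x, hx, hxU⟩ => ?_⟩
  · have hfin := hb.isCompact.measure_lt_top
      (μ := Measure.euclideanHausdorffMeasure (Module.finrank ℝ (vectorSpan ℝ F)))
    rwa [← hiso.euclideanHausdorffMeasure_image, himg] at hfin
  · rw [← himg] at hx
    obtain ⟨w, hw, rfl⟩ := hx
    have hne := mem_closure_iff.1 (hb.subset_closure_interior hw) (φ ⁻¹' U)
      (hU.preimage hiso.continuous) hxU
    have hpos := ((hU.preimage hiso.continuous).inter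
      (isOpen_interior (s := φ ⁻¹' F))).measure_pos
      (Measure.euclideanHausdorffMeasure (Module.finrank ℝ (vectorSpan ℝ F))) hne
    rw [← hiso.euclideanHausdorffMeasure_image] at hpos
    refine hpos.trans_le (measure_mono ?_)
    rintro _ ⟨v, ⟨hv, hv'⟩, rfl⟩
    exact ⟨(interior_subset hv' : v ∈ φ ⁻¹' F), hv⟩

end Biot

namespace Biot

open MvPolynomial Matrix

/-! ### Infinitesimal rigid motions -/

theorem eq_C_of_pderiv_eq_zero {d : ℕ} {p : MvPolynomial (Fin d) ℝ}
    (hp : ∀ i, pderiv i p = 0) : p = C (coeff 0 p) := by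
  ext m
  rw [coeff_C]
  split_ifs with h
  · rw [← h]
  · obtain ⟨i, hi⟩ : ∃ i, m i ≠ 0 := by
      by_contra! hcon
      exact h (Finsupp.ext fun i => (hcon i).symm)
    have hm : m - Finsupp.single i 1 + Finsupp.single i 1 = m :=
      tsub_add_cancel_of_le (Finsupp.single_le_iff.2 (Nat.one_le_iff_ne_zero.2 hi))
    have h0 := congrArg (coeff (m - Finsupp.single i 1)) (hp i)
    rw [coeff_pderiv, hm, coeff_zero] at h0
    rcases mul_eq_zero.1 h0 with h1 | h1
    · exact h1
    · exact absurd h1 (by positivity)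

/-- A polynomial vector field with vanishing strain is an infinitesimal rigid motion. -/
theorem exists_rigid_motion {d : ℕ} {v : Fin d → MvPolynomial (Fin d) ℝ}
    (hv : ∀ i j, pderiv j (v i) + pderiv i (v j) = 0) :
    ∃ (S : Matrix (Fin d) (Fin d) ℝ) (b : Fin d → ℝ), Sᵀ = -S ∧
      ∀ (i : Fin d) (x : E d), val (v i) x = b i + (S *ᵥ x) i := by
  have hcomm : ∀ (k j : Fin d) (f : MvPolynomial (Fin d) ℝ),
      pderiv k (pderiv j f) = pderiv j (pderiv k f) := by
    intro k j f
    ext m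
    simp only [coeff_pderiv, Finsupp.add_apply, add_right_comm m]
    by_cases hkj : k = j
    · rw [hkj]
    · simp only [Finsupp.single_eq_of_ne hkj, Finsupp.single_eq_of_ne (Ne.symm hkj)]
      push_cast
      ring
  have hneg : ∀ i j, pderiv j (v i) = -pderiv i (v j) :=
    fun i j => eq_neg_of_add_eq_zero_left (hv i j)
  -- Exchanging the component with a differentiation index changes the sign of ∂ₖ∂ⱼvᵢ; three
  -- exchanges lead back to the same term with a minus sign.
  have hsec : ∀ i j k, pderiv k (pderiv j (v i)) = 0 := by
    intro i j k
    have h : pderiv k (pderiv j (v i)) = -pderiv k (pderiv j (v i)) := by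
      calc pderiv k (pderiv j (v i)) = -pderiv i (pderiv k (v j)) := by
            rw [hneg i j, map_neg, hcomm]
        _ = pderiv j (pderiv i (v k)) := by rw [hneg j k, map_neg, neg_neg, hcomm]
        _ = -pderiv k (pderiv j (v i)) := by rw [hneg k i, map_neg, hcomm]
    exact self_eq_neg.1 h
  let S : Matrix (Fin d) (Fin d) ℝ := fun i j => coeff 0 (pderiv j (v i))
  have hS : ∀ i j, pderiv j (v i) = C (S i j) := fun i j => eq_C_of_pderiv_eq_zero (hsec i j)
  have hlin : ∀ i, v i - ∑ j, C (S i j) * X j =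
      C (coeff 0 (v i - ∑ j, C (S i j) * X j)) := by
    intro i
    refine eq_C_of_pderiv_eq_zero fun k => ?_
    rw [map_sub, hS, map_sum]
    simp [pderiv_X, Pi.single_apply]
  refine ⟨S, fun i => coeff 0 (v i - ∑ j, C (S i j) * X j), ?_, fun i x => ?_⟩
  · ext i j
    have h := congrArg (coeff 0) (hneg j i)
    rw [coeff_neg] at h
    exact h
  · have h := congrArg (fun f => val f x) (hlin i)
    simp only [val_sub, val_sum, val_mul] at h
    rw [sub_eq_iff_eq_add] at h
    rw [h]
    simp [val, mulVec, dotProduct]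

/-- An infinitesimal rigid motion that vanishes on a set of codimension one is zero. -/
theorem eq_zero_of_strain_eq_zero_of_facet {d : ℕ} {v : Fin d → MvPolynomial (Fin d) ℝ}
    (hv : ∀ i j, pderiv j (v i) + pderiv i (v j) = 0) {F : Set (E d)} (hne : F.Nonempty)
    (hF : Module.finrank ℝ (vectorSpan ℝ F) + 1 = d) (h0 : ∀ x ∈ F, ∀ i, val (v i) x = 0) :
    v = 0 := by
  obtain ⟨S, b, hS, hval⟩ := exists_rigid_motion hv
  have hker : ∀ w ∈ vectorSpan ℝ F, S *ᵥ w = 0 := by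
    intro w hw
    rw [vectorSpan_def] at hw
    induction hw using Submodule.span_induction with
    | mem z hz =>
      obtain ⟨x, hx, y, hy, rfl⟩ := hz
      ext i
      have h1 := h0 x hx i
      have h2 := h0 y hy i
      rw [hval] at h1 h2
      simp only [vsub_eq_sub, WithLp.ofLp_sub, mulVec_sub, Pi.sub_apply, Pi.zero_apply]
      linarith
    | zero => simp
    | add x y _ _ hx hy => simp [mulVec_add, hx, hy]
    | smul c x _ hx => simp [mulVec_smul, hx]
  obtain ⟨n, -, hdec⟩ := Mesh.exists_unit_normal hF
  have hanti : ∀ x y : Fin d → ℝ, (S *ᵥ x) ⬝ᵥ y = -(x ⬝ᵥ (S *ᵥ y)) := by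
    intro x y
    rw [dotProduct_mulVec x, ← mulVec_transpose, hS, neg_mulVec, neg_dotProduct, neg_neg]
  -- By antisymmetry, S n is orthogonal to the hyperplane, on which S vanishes, and to n itself.
  have hn : S *ᵥ n = 0 := by
    refine dotProduct_eq_zero_iff.1 fun y => ?_
    obtain ⟨w, hw, s, hy, -⟩ := hdec (WithLp.toLp 2 y)
    have hy' : y = w.ofLp + s • n.ofLp := by simpa using congrArg WithLp.ofLp hy
    have h1 : (S *ᵥ n) ⬝ᵥ w.ofLp = 0 := by rw [hanti, hker w hw, dotProduct_zero, neg_zero]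
    have h2 : (S *ᵥ n) ⬝ᵥ n.ofLp = 0 := by
      have h := hanti n n
      rw [dotProduct_comm n.ofLp] at h
      linarith
    rw [hy', dotProduct_add, dotProduct_smul, h1, h2, smul_zero, add_zero]
  have hall : ∀ x : E d, S *ᵥ x = 0 := by
    intro x
    obtain ⟨w, hw, s, hx, -⟩ := hdec x
    rw [hx]
    simp [mulVec_add, mulVec_smul, hker w hw, hn]
  obtain ⟨x₀, hx₀⟩ := hne
  funext i
  refine eq_zero_of_val_eq_zero (T := Set.univ) (by simp) fun x _ => ?_
  have h := h0 x₀ hx₀ i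
  rw [hval, hall] at h
  rw [hval, hall, h]

/-- A piecewise rigid motion without jumps that vanishes on a boundary face is zero. -/
theorem Mesh.eq_zero_of_strain_eq_zero {d : ℕ} (hd : 2 ≤ d) {ι I B : Type*} [Finite ι]
    (M : Mesh d ι I B) (hΩ : IsConnected M.domain) {Γ : Finset B} (hΓ : Γ.Nonempty)
    {v : Vect d ι} (hs : ∀ T i j, pderiv j (v T i) + pderiv i (v T j) = 0)
    (hj : ∀ F, ∀ x ∈ M.iface F, ∀ i, val (v (M.minus F) i) x = val (v (M.plus F) i) x)
    (hb : ∀ F ∈ Γ, ∀ x ∈ M.bface F, ∀ i, val (v (M.owner F) i) x = 0) : v = 0 := by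
  funext T
  refine M.forall_of_face_closed hd hΩ {T | v T = 0} ?_ (fun F => ?_) T
  · obtain ⟨F, hF⟩ := hΓ
    exact ⟨M.owner F, eq_zero_of_strain_eq_zero_of_facet (hs _) (M.facet_owner F).1
      (M.facet_owner F).2.2 (hb F hF)⟩
  -- Across a face, the difference of two rigid motions is a rigid motion that vanishes on the face.
  · have h : v (M.minus F) - v (M.plus F) = 0 := by
      refine eq_zero_of_strain_eq_zero_of_facet (fun i j => ?_) (M.facet_minus F).1
        (M.facet_minus F).2.2 fun x hx i => ?_
      · have h1 := hs (M.minus F) i j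
        have h2 := hs (M.plus F) i j
        simp only [Pi.sub_apply, map_sub]
        linear_combination h1 - h2
      · rw [Pi.sub_apply, val_sub, hj F x hx i, sub_self]
    rw [Set.mem_ofPred_eq, Set.mem_ofPred_eq, sub_eq_zero.1 h]

end Biot

namespace Biot

open MeasureTheory

/-! ### Comparison of positive semidefinite forms -/

/-- A symmetric positive semidefinite bilinear form. -/
structure IsSymmNonneg {V : Type*} [AddCommGroup V] [Module ℝ V] (B : V →ₗ[ℝ] V →ₗ[ℝ] ℝ) :
    Prop where
  symm : ∀ x y, B x y = B y x
  nonneg : ∀ x, 0 ≤ B x x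

namespace IsSymmNonneg

variable {V : Type*} [AddCommGroup V] [Module ℝ V] {A B : V →ₗ[ℝ] V →ₗ[ℝ] ℝ}

theorem add (hA : IsSymmNonneg A) (hB : IsSymmNonneg B) : IsSymmNonneg (A + B) :=
  ⟨fun x y => by simp [hA.symm x y, hB.symm x y],
    fun x => by simpa using add_nonneg (hA.nonneg x) (hB.nonneg x)⟩

theorem sum {α : Type*} {s : Finset α} {A : α → V →ₗ[ℝ] V →ₗ[ℝ] ℝ}
    (hA : ∀ a ∈ s, IsSymmNonneg (A a)) : IsSymmNonneg (∑ a ∈ s, A a) :=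
  ⟨fun x y => by
      simp only [LinearMap.sum_apply]
      exact Finset.sum_congr rfl fun a ha => (hA a ha).symm x y,
    fun x => by
      simp only [LinearMap.sum_apply]
      exact Finset.sum_nonneg fun a ha => (hA a ha).nonneg x⟩

theorem comp {V' : Type*} [AddCommGroup V'] [Module ℝ V'] (hA : IsSymmNonneg A)
    (f : V' →ₗ[ℝ] V) : IsSymmNonneg (A.compl₁₂ f f) :=
  ⟨fun x y => by simpa using hA.symm (f x) (f y), fun x => by simpa using hA.nonneg (f x)⟩

theorem two_mul_le (hA : IsSymmNonneg A) (x y : V) : 2 * A x y ≤ A x x + A y y := by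
  have h := hA.nonneg (x - y)
  simp only [map_sub, LinearMap.sub_apply] at h
  have := hA.symm x y
  linarith

theorem apply_sum_le (hA : IsSymmNonneg A) {n : ℕ} (x : Fin n → V) :
    A (∑ i, x i) (∑ i, x i) ≤ n * ∑ i, A (x i) (x i) := by
  have h1 : A (∑ i, x i) (∑ i, x i) = ∑ i, ∑ j, A (x i) (x j) := by
    simp only [map_sum, LinearMap.sum_apply]
    exact Finset.sum_comm
  have h2 : ∑ i, ∑ j, 2 * A (x i) (x j) ≤ ∑ i, ∑ j, (A (x i) (x i) + A (x j) (x j)) :=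
    Finset.sum_le_sum fun i _ => Finset.sum_le_sum fun j _ => hA.two_mul_le _ _
  simp only [Finset.sum_add_distrib, Finset.sum_const, Finset.card_univ, Fintype.card_fin,
    nsmul_eq_mul, ← Finset.mul_sum] at h2
  rw [h1]
  linarith

/-- On a finite dimensional space, a form is dominated by another one as soon as it vanishes where
the other one vanishes. -/
theorem exists_le_mul [FiniteDimensional ℝ V] (hA : IsSymmNonneg A) (hB : IsSymmNonneg B)
    (h : ∀ x, A x x = 0 → B x x = 0) : ∃ C : ℝ, 0 ≤ C ∧ ∀ x, B x x ≤ C * A x x := by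
  have : Invertible (2 : ℝ) := invertibleOfNonzero two_ne_zero
  obtain ⟨n, b, hb⟩ : ∃ n, ∃ b : Module.Basis (Fin n) ℝ V, LinearMap.IsOrthoᵢ A b :=
    ⟨_, LinearMap.BilinForm.exists_orthogonal_basis ⟨hA.symm⟩⟩
  -- A zero denominator gives `c i = 0`, which is the right value since then `B (b i) (b i) = 0` by
  -- hypothesis.
  let c : Fin n → ℝ := fun i => B (b i) (b i) / A (b i) (b i)
  have hc : ∀ i, 0 ≤ c i := fun i => div_nonneg (hB.nonneg _) (hA.nonneg _)
  have hcb : ∀ i, B (b i) (b i) = c i * A (b i) (b i) := by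
    intro i
    by_cases h0 : A (b i) (b i) = 0
    · rw [h _ h0, h0, mul_zero]
    · rw [div_mul_cancel₀ _ h0]
  refine ⟨n * ∑ i, c i, by positivity [Finset.sum_nonneg fun i (_ : i ∈ Finset.univ) => hc i],
    fun x => ?_⟩
  have hx := b.sum_repr x
  -- The basis need not be orthogonal for `B`; the cross terms cost the factor n.
  have hBx : B x x ≤ n * ∑ i, (b.repr x i) ^ 2 * B (b i) (b i) := by
    have h1 := hB.apply_sum_le fun i => b.repr x i • b i
    rw [hx] at h1
    refine h1.trans (le_of_eq ?_)
    congr 1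
    refine Finset.sum_congr rfl fun i _ => ?_
    simp only [map_smul, LinearMap.smul_apply, smul_eq_mul]
    ring
  have hAx : A x x = ∑ i, (b.repr x i) ^ 2 * A (b i) (b i) := by
    conv_lhs => rw [← hx]
    simp only [map_sum, LinearMap.sum_apply, map_smul, LinearMap.smul_apply, smul_eq_mul]
    refine Finset.sum_congr rfl fun i _ => ?_
    rw [Finset.sum_eq_single i]
    · ring
    · intro j _ hji
      have h0 : A (b j) (b i) = 0 := hb hji
      rw [h0]
      ring
    · simp
  refine hBx.trans ?_
  rw [mul_assoc]
  refine mul_le_mul_of_nonneg_left ?_ (Nat.cast_nonneg n)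
  rw [hAx, Finset.mul_sum]
  refine Finset.sum_le_sum fun i _ => ?_
  rw [hcb]
  have h1 : c i ≤ ∑ i, c i := Finset.single_le_sum (fun i _ => hc i) (Finset.mem_univ i)
  have h2 : 0 ≤ b.repr x i ^ 2 * A (b i) (b i) := mul_nonneg (sq_nonneg _) (hA.nonneg _)
  nlinarith

end IsSymmNonneg

/-! ### The discrete forms as bilinear maps -/

section Form

variable {d : ℕ} {V : Type*} [AddCommGroup V] [Module ℝ V] {μ : Measure (E d)} {K : Set (E d)}

/-- The bilinear form `(u, v) ↦ ∫_K (f u) (g v)`. -/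
noncomputable def IsThick.form (h : IsThick μ K) (f g : V →ₗ[ℝ] MvPolynomial (Fin d) ℝ) :
    V →ₗ[ℝ] V →ₗ[ℝ] ℝ :=
  ((LinearMap.mul ℝ (MvPolynomial (Fin d) ℝ)).compr₂ h.integral).compl₁₂ f g

@[simp] theorem IsThick.form_apply (h : IsThick μ K) (f g : V →ₗ[ℝ] MvPolynomial (Fin d) ℝ)
    (u v : V) : h.form f g u v = h.integral (f u * g v) := rfl

theorem IsThick.form_self (h : IsThick μ K) (f : V →ₗ[ℝ] MvPolynomial (Fin d) ℝ) :
    IsSymmNonneg (h.form f f) :=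
  ⟨fun u v => by rw [form_apply, form_apply, mul_comm],
    fun u => h.integral_nonneg (f := f u * f u) fun x => by
      rw [val_mul]
      exact mul_self_nonneg _⟩

theorem IsThick.val_eq_zero_of_form (h : IsThick μ K) {f : V →ₗ[ℝ] MvPolynomial (Fin d) ℝ} {u : V}
    (h0 : h.form f f u u = 0) : ∀ x ∈ K, val (f u) x = 0 := fun x hx => by
  have := h.val_eq_zero_of_integral_eq_zero (f := f u * f u)
    (fun x => by rw [val_mul]; exact mul_self_nonneg _) h0 x hx
  rw [val_mul] at this
  exact mul_self_eq_zero.1 this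

/-- Expand the nonnegative square of s f - g and divide by s. -/
theorem IsThick.form_young (h : IsThick μ K) (f g : V →ₗ[ℝ] MvPolynomial (Fin d) ℝ) (u : V) {s : ℝ}
    (hs : 0 < s) : 2 * h.form f g u u ≤ s * h.form f f u u + s⁻¹ * h.form g g u u := by
  have h1 := (h.form_self (s • f - g)).nonneg u
  simp only [form_apply, LinearMap.sub_apply, LinearMap.smul_apply] at h1 ⊢
  have h2 : (s • f u - g u) * (s • f u - g u) =
      (s * s) • (f u * f u) - (2 * s) • (f u * g u) + g u * g u := by
    simp only [MvPolynomial.smul_eq_C_mul, map_mul, map_ofNat]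
    ring
  rw [h2, map_add, map_sub, map_smul, map_smul, smul_eq_mul, smul_eq_mul] at h1
  have h3 : s⁻¹ * (s * s * h.integral (f u * f u) - 2 * s * h.integral (f u * g u)
      + h.integral (g u * g u)) = s * h.integral (f u * f u) - 2 * h.integral (f u * g u)
      + s⁻¹ * h.integral (g u * g u) := by
    field_simp
  have h4 := mul_nonneg (inv_pos.2 hs).le h1
  rw [h3] at h4
  linarith

end Form

namespace Mesh

variable {d : ℕ} {ι I B : Type*}

/-- The component `i` of a vector field on the element `T`. -/
noncomputable def compL (T : ι) (i : Fin d) : Vect d ι →ₗ[ℝ] MvPolynomial (Fin d) ℝ :=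
  LinearMap.proj i ∘ₗ LinearMap.proj T

/-- The entry `i j` of the gradient on the element `T`. -/
noncomputable def gradL (T : ι) (i j : Fin d) : Vect d ι →ₗ[ℝ] MvPolynomial (Fin d) ℝ :=
  (MvPolynomial.pderiv j).toLinearMap ∘ₗ compL T i

/-- The entry `i j` of the strain on the element `T`. -/
noncomputable def strainL (T : ι) (i j : Fin d) : Vect d ι →ₗ[ℝ] MvPolynomial (Fin d) ℝ :=
  (2⁻¹ : ℝ) • (gradL T i j + gradL T j i)

/-- The component `i` of `ε(v) n` on the element `T`. -/
noncomputable def strainNL (T : ι) (n : E d) (i : Fin d) :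
    Vect d ι →ₗ[ℝ] MvPolynomial (Fin d) ℝ :=
  ∑ j, n j • strainL T i j

/-- The component `i` of the jump across an interior face. -/
noncomputable def jumpL (M : Mesh d ι I B) (F : I) (i : Fin d) :
    Vect d ι →ₗ[ℝ] MvPolynomial (Fin d) ℝ :=
  compL (M.minus F) i - compL (M.plus F) i

/-- The component `i` of the average of `ε(v) n` on an interior face. -/
noncomputable def avgL (M : Mesh d ι I B) (F : I) (i : Fin d) :
    Vect d ι →ₗ[ℝ] MvPolynomial (Fin d) ℝ :=
  (2⁻¹ : ℝ) • (strainNL (M.minus F) (M.inormal F) i + strainNL (M.plus F) (M.inormal F) i)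

@[simp] theorem val_compL (T : ι) (i : Fin d) (v : Vect d ι) (x : E d) :
    val (compL T i v) x = val (v T i) x := rfl

@[simp] theorem val_gradL (T : ι) (i j : Fin d) (v : Vect d ι) (x : E d) :
    val (gradL T i j v) x = grad (v T) i j x := rfl

@[simp] theorem val_strainL (T : ι) (i j : Fin d) (v : Vect d ι) (x : E d) :
    val (strainL T i j v) x = strain (v T) i j x := by
  simp [strainL, strain]
  ring

@[simp] theorem val_strainNL (T : ι) (n : E d) (i : Fin d) (v : Vect d ι) (x : E d) :
    val (strainNL T n i v) x = strainN (v T) n i x := by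
  simp [strainNL, strainN, LinearMap.sum_apply, mul_comm]

@[simp] theorem val_jumpL (M : Mesh d ι I B) (F : I) (i : Fin d) (v : Vect d ι) (x : E d) :
    val (M.jumpL F i v) x = M.jump v F i x := by
  simp [jumpL, jump]

@[simp] theorem val_avgL (M : Mesh d ι I B) (F : I) (i : Fin d) (v : Vect d ι) (x : E d) :
    val (M.avgL F i v) x = M.avgStrainN v F i x := by
  simp [avgL, avgStrainN]
  ring

variable (M : Mesh d ι I B)

theorem isThick_elem (hd : 2 ≤ d) (T : ι) : IsThick volume (M.elem T) := (M.isBody hd T).isThick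

theorem isThick_iface (hd : 2 ≤ d) (F : I) :
    IsThick (Measure.euclideanHausdorffMeasure (d - 1)) (M.iface F) :=
  (M.facet_minus F).isThick (M.isBody hd _)

theorem isThick_bface (hd : 2 ≤ d) (F : B) :
    IsThick (Measure.euclideanHausdorffMeasure (d - 1)) (M.bface F) :=
  (M.facet_owner F).isThick (M.isBody hd _)

/-- The form `(ε(u), ε(v))`. -/
noncomputable def strainForm [Fintype ι] (hd : 2 ≤ d) : Vect d ι →ₗ[ℝ] Vect d ι →ₗ[ℝ] ℝ :=
  ∑ T, ∑ i, ∑ j, (M.isThick_elem hd T).form (strainL T i j) (strainL T i j)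

/-- The form `(∇u, ∇v)`. -/
noncomputable def gradForm [Fintype ι] (hd : 2 ≤ d) : Vect d ι →ₗ[ℝ] Vect d ι →ₗ[ℝ] ℝ :=
  ∑ T, ∑ i, ∑ j, (M.isThick_elem hd T).form (gradL T i j) (gradL T i j)

/-- The jump terms on interior faces and on the boundary faces in `Γ`. -/
noncomputable def jumpForm [Fintype I] (hd : 2 ≤ d) (Γ : Finset B) :
    Vect d ι →ₗ[ℝ] Vect d ι →ₗ[ℝ] ℝ :=
  (∑ F, ∑ i, (M.isThick_iface hd F).form (M.jumpL F i) (M.jumpL F i)) +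
    ∑ F ∈ Γ, ∑ i, (M.isThick_bface hd F).form (compL (M.owner F) i) (compL (M.owner F) i)

/-- The squares of the normal strains on the faces. -/
noncomputable def fluxForm [Fintype I] (hd : 2 ≤ d) (Γ : Finset B) :
    Vect d ι →ₗ[ℝ] Vect d ι →ₗ[ℝ] ℝ :=
  (∑ F, ∑ i, (M.isThick_iface hd F).form (M.avgL F i) (M.avgL F i)) +
    ∑ F ∈ Γ, ∑ i, (M.isThick_bface hd F).form (strainNL (M.owner F) (M.bnormal F) i)
      (strainNL (M.owner F) (M.bnormal F) i)

/-- The consistency terms, with the normal strain of the first argument and the jump of the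
second one. -/
noncomputable def consistencyForm [Fintype I] (hd : 2 ≤ d) (Γ : Finset B) :
    Vect d ι →ₗ[ℝ] Vect d ι →ₗ[ℝ] ℝ :=
  (∑ F, ∑ i, (M.isThick_iface hd F).form (M.avgL F i) (M.jumpL F i)) +
    ∑ F ∈ Γ, ∑ i, (M.isThick_bface hd F).form (strainNL (M.owner F) (M.bnormal F) i)
      (compL (M.owner F) i)

theorem dForm_eq [Fintype ι] [Fintype I] (hd : 2 ≤ d) (Γ : Finset B) (γ : ℝ) (u v : Vect d ι) :
    M.dForm Γ γ u v = 2 * M.strainForm hd u v + γ / M.size * M.jumpForm hd Γ u v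
      - 2 * M.consistencyForm hd Γ u v - 2 * M.consistencyForm hd Γ v u := by
  simp only [dForm, strainForm, jumpForm, consistencyForm, LinearMap.add_apply,
    LinearMap.sum_apply, IsThick.form_apply]
  simp only [← map_sum]
  simp only [IsThick.integral_apply, val_sum, val_mul,
    val_compL, val_jumpL, val_avgL, val_strainL, val_strainNL, faceInt]
  ring

theorem normSq_eq [Fintype ι] [Fintype I] (hd : 2 ≤ d) (Γ : Finset B) (γ : ℝ) (v : Vect d ι) :
    M.normSq Γ γ v = M.gradForm hd v v + γ / M.size * M.jumpForm hd Γ v v := by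
  simp only [normSq, gradForm, jumpForm, LinearMap.add_apply,
    LinearMap.sum_apply, IsThick.form_apply]
  simp only [← map_sum]
  simp only [IsThick.integral_apply, val_sum, val_mul,
    val_compL, val_jumpL, val_gradL, faceInt, ← Finset.mul_sum, sq]
  ring

theorem isSymmNonneg_strainForm [Fintype ι] (hd : 2 ≤ d) : IsSymmNonneg (M.strainForm hd) :=
  .sum fun _ _ => .sum fun _ _ => .sum fun _ _ => IsThick.form_self _ _

theorem isSymmNonneg_gradForm [Fintype ι] (hd : 2 ≤ d) : IsSymmNonneg (M.gradForm hd) :=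
  .sum fun _ _ => .sum fun _ _ => .sum fun _ _ => IsThick.form_self _ _

theorem isSymmNonneg_jumpForm [Fintype I] (hd : 2 ≤ d) (Γ : Finset B) :
    IsSymmNonneg (M.jumpForm hd Γ) :=
  .add (.sum fun _ _ => .sum fun _ _ => IsThick.form_self _ _)
    (.sum fun _ _ => .sum fun _ _ => IsThick.form_self _ _)

theorem isSymmNonneg_fluxForm [Fintype I] (hd : 2 ≤ d) (Γ : Finset B) :
    IsSymmNonneg (M.fluxForm hd Γ) :=
  .add (.sum fun _ _ => .sum fun _ _ => IsThick.form_self _ _)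
    (.sum fun _ _ => .sum fun _ _ => IsThick.form_self _ _)

theorem two_mul_consistencyForm_le [Fintype I] (hd : 2 ≤ d) (Γ : Finset B) (u : Vect d ι)
    {s : ℝ} (hs : 0 < s) :
    2 * M.consistencyForm hd Γ u u ≤ s * M.fluxForm hd Γ u u + s⁻¹ * M.jumpForm hd Γ u u := by
  simp only [consistencyForm, fluxForm, jumpForm, LinearMap.add_apply, LinearMap.sum_apply]
  rw [mul_add, mul_add, mul_add, add_add_add_comm]
  simp only [Finset.mul_sum, ← Finset.sum_add_distrib]
  exact add_le_add
    (Finset.sum_le_sum fun F _ => Finset.sum_le_sum fun i _ => IsThick.form_young _ _ _ u hs)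
    (Finset.sum_le_sum fun F _ => Finset.sum_le_sum fun i _ => IsThick.form_young _ _ _ u hs)

variable {M}

theorem strainL_eq_zero [Fintype ι] (hd : 2 ≤ d) {u : Vect d ι}
    (h : M.strainForm hd u u = 0) (T : ι) (i j : Fin d) :
    strainL T i j u = 0 := by
  simp only [strainForm, LinearMap.sum_apply] at h
  have hnn : ∀ T i j, 0 ≤ (M.isThick_elem hd T).form (strainL T i j) (strainL T i j) u u :=
    fun T i j => (IsThick.form_self _ _).nonneg u
  have h1 := (Finset.sum_eq_zero_iff_of_nonneg fun T _ => Finset.sum_nonneg fun i _ =>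
    Finset.sum_nonneg fun j _ => hnn T i j).1 h T (Finset.mem_univ T)
  have h2 := (Finset.sum_eq_zero_iff_of_nonneg fun i _ =>
    Finset.sum_nonneg fun j _ => hnn T i j).1 h1 i (Finset.mem_univ i)
  have h3 := (Finset.sum_eq_zero_iff_of_nonneg fun j _ => hnn T i j).1 h2 j (Finset.mem_univ j)
  exact eq_zero_of_val_eq_zero (M.isBody hd T).nonempty_interior (IsThick.val_eq_zero_of_form _ h3)

theorem gradL_eq_zero [Fintype ι] (hd : 2 ≤ d) {u : Vect d ι}
    (h : M.gradForm hd u u = 0) (T : ι) (i j : Fin d) :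
    gradL T i j u = 0 := by
  simp only [gradForm, LinearMap.sum_apply] at h
  have hnn : ∀ T i j, 0 ≤ (M.isThick_elem hd T).form (gradL T i j) (gradL T i j) u u :=
    fun T i j => (IsThick.form_self _ _).nonneg u
  have h1 := (Finset.sum_eq_zero_iff_of_nonneg fun T _ => Finset.sum_nonneg fun i _ =>
    Finset.sum_nonneg fun j _ => hnn T i j).1 h T (Finset.mem_univ T)
  have h2 := (Finset.sum_eq_zero_iff_of_nonneg fun i _ =>
    Finset.sum_nonneg fun j _ => hnn T i j).1 h1 i (Finset.mem_univ i)
  have h3 := (Finset.sum_eq_zero_iff_of_nonneg fun j _ => hnn T i j).1 h2 j (Finset.mem_univ j)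
  exact eq_zero_of_val_eq_zero (M.isBody hd T).nonempty_interior (IsThick.val_eq_zero_of_form _ h3)

/-- The kernel condition behind the discrete trace inequality: strains that vanish on elements are
zero polynomials, so they vanish on faces too. -/
theorem fluxForm_eq_zero [Fintype ι] [Fintype I] (hd : 2 ≤ d) {Γ : Finset B} {u : Vect d ι}
    (h : M.strainForm hd u u = 0) :
    M.fluxForm hd Γ u u = 0 := by
  have hs := strainL_eq_zero hd h
  have hn : ∀ T n i, strainNL T n i u = 0 := fun T n i => by
    simp [strainNL, LinearMap.sum_apply, hs]
  simp [fluxForm, LinearMap.sum_apply, avgL, hn]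

/-- Strains and jumps determine a piecewise polynomial vector field. -/
theorem eq_zero_of_forms_eq_zero [Finite ι] [Fintype I] (hd : 2 ≤ d) {Γ : Finset B}
    (hΩ : IsConnected M.domain) (hΓ : Γ.Nonempty) {u : Vect d ι}
    (hs : ∀ T i j, strainL T i j u = 0) (hJ : M.jumpForm hd Γ u u = 0) : u = 0 := by
  have hi : ∀ F i, 0 ≤ (M.isThick_iface hd F).form (M.jumpL F i) (M.jumpL F i) u u :=
    fun F i => (IsThick.form_self _ _).nonneg u
  have hb : ∀ F i, 0 ≤ (M.isThick_bface hd F).form (compL (M.owner F) i)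
      (compL (M.owner F) i) u u := fun F i => (IsThick.form_self _ _).nonneg u
  simp only [jumpForm, LinearMap.add_apply, LinearMap.sum_apply] at hJ
  obtain ⟨h1, h2⟩ := (add_eq_zero_iff_of_nonneg
    (Finset.sum_nonneg fun F _ => Finset.sum_nonneg fun i _ => hi F i)
    (Finset.sum_nonneg fun F _ => Finset.sum_nonneg fun i _ => hb F i)).1 hJ
  refine M.eq_zero_of_strain_eq_zero hd hΩ hΓ (fun T i j => ?_) (fun F x hx i => ?_)
    fun F hF x hx i => ?_
  · have h := hs T i j
    rw [strainL, LinearMap.smul_apply, smul_eq_zero] at h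
    exact h.resolve_left (by norm_num)
  · have h3 := (Finset.sum_eq_zero_iff_of_nonneg fun F _ =>
      Finset.sum_nonneg fun i _ => hi F i).1 h1 F (Finset.mem_univ F)
    have h4 := (Finset.sum_eq_zero_iff_of_nonneg fun i _ => hi F i).1 h3 i (Finset.mem_univ i)
    have h5 := IsThick.val_eq_zero_of_form _ h4 x hx
    rw [val_jumpL] at h5
    exact sub_eq_zero.1 h5
  · have h3 := (Finset.sum_eq_zero_iff_of_nonneg fun F _ =>
      Finset.sum_nonneg fun i _ => hb F i).1 h2 F hF
    have h4 := (Finset.sum_eq_zero_iff_of_nonneg fun i _ => hb F i).1 h3 i (Finset.mem_univ i)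
    exact IsThick.val_eq_zero_of_form _ h4 x hx

/-! ### Definiteness of the mesh norm and coercivity -/

variable (M)

theorem normSq_nonneg [Fintype ι] [Fintype I] (hd : 2 ≤ d) {Γ : Finset B} {γ : ℝ}
    (hγ : 0 ≤ γ) (v : Vect d ι) : 0 ≤ M.normSq Γ γ v := by
  rw [M.normSq_eq hd]
  exact add_nonneg ((M.isSymmNonneg_gradForm hd).nonneg v) (mul_nonneg
    (div_nonneg hγ (Real.iSup_nonneg fun _ => Metric.diam_nonneg))
    ((M.isSymmNonneg_jumpForm hd Γ).nonneg v))

theorem eq_zero_of_normSq_eq_zero [Fintype ι] [Fintype I] (hd : 2 ≤ d) {Γ : Finset B}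
    (hΩ : IsConnected M.domain) (hΓ : Γ.Nonempty) {γ : ℝ}
    (hγ : 0 < γ) {v : Vect d ι} (hv : M.normSq Γ γ v = 0) : v = 0 := by
  obtain ⟨F, -⟩ := hΓ.exists_mem
  have hpos : 0 < γ / M.size := div_pos hγ (M.size_pos hd (M.owner F))
  rw [M.normSq_eq hd] at hv
  obtain ⟨h1, h2⟩ := (add_eq_zero_iff_of_nonneg ((M.isSymmNonneg_gradForm hd).nonneg v)
    (mul_nonneg hpos.le ((M.isSymmNonneg_jumpForm hd Γ).nonneg v))).1 hv
  refine eq_zero_of_forms_eq_zero hd hΩ hΓ (fun T i j => ?_)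
    ((mul_eq_zero.1 h2).resolve_left hpos.ne')
  simp [strainL, gradL_eq_zero hd h1]

/-- Coercivity of the interior penalty form for large penalty parameters. -/
theorem exists_coercive [Fintype ι] [Fintype I] (hd : 2 ≤ d) {Γ : Finset B}
    (hΩ : IsConnected M.domain) (hΓ : Γ.Nonempty)
    (V : Submodule ℝ (Vect d ι)) [FiniteDimensional ℝ V] :
    ∃ γ₀ : ℝ, 0 < γ₀ ∧ ∀ γ ≥ γ₀, M.Coercive Γ γ V := by
  obtain ⟨F, -⟩ := hΓ.exists_mem
  have hsize := M.size_pos hd (M.owner F)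
  have hS := M.isSymmNonneg_strainForm hd
  have hJ := M.isSymmNonneg_jumpForm hd Γ
  -- Discrete trace inequality.
  obtain ⟨C, hC0, hC⟩ := (hS.comp V.subtype).exists_le_mul
    ((M.isSymmNonneg_fluxForm hd Γ).comp V.subtype) fun x hx => fluxForm_eq_zero hd hx
  -- Discrete Korn inequality.
  obtain ⟨D, hD0, hD⟩ := ((hS.add hJ).comp V.subtype).exists_le_mul
    ((M.isSymmNonneg_gradForm hd).comp V.subtype) fun x hx => by
      obtain ⟨h1, h2⟩ := (add_eq_zero_iff_of_nonneg (hS.nonneg (x : Vect d ι))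
        (hJ.nonneg (x : Vect d ι))).1 hx
      have h0 := eq_zero_of_forms_eq_zero hd hΩ hΓ (strainL_eq_zero hd h1) h2
      simp [h0]
  -- Let e and J be the strain and jump forms. Young's inequality with s = 1/(2(C+1)) bounds the
  -- consistency terms by e + 4(C+1)J. For γ/h ≥ 8(C+1) at least e + (γ/h)J/2 remains, and 1/(2D+4)
  -- times the squared norm stays below this by Korn.
  refine ⟨8 * (C + 1) * M.size, by positivity, fun γ hγ => ⟨(2 * D + 4)⁻¹, by positivity, ?_⟩⟩
  intro v hv
  have hβ : 8 * (C + 1) ≤ γ / M.size := (le_div_iff₀ hsize).2 hγ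
  rw [M.dForm_eq hd, M.normSq_eq hd]
  have hCv : M.fluxForm hd Γ v v ≤ C * M.strainForm hd v v := hC ⟨v, hv⟩
  have hDv : M.gradForm hd v v ≤ D * (M.strainForm hd v v + M.jumpForm hd Γ v v) := hD ⟨v, hv⟩
  have hX := M.two_mul_consistencyForm_le hd Γ v (s := (2 * (C + 1))⁻¹) (by positivity)
  rw [inv_inv] at hX
  have hSv := hS.nonneg v
  have hJv := hJ.nonneg v
  generalize γ / M.size = β at *
  generalize M.strainForm hd v v = e at *
  generalize M.jumpForm hd Γ v v = J at *
  generalize M.gradForm hd v v = G at *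
  generalize M.fluxForm hd Γ v v = N at *
  generalize M.consistencyForm hd Γ v v = X at *
  have h1 : (2 * (C + 1))⁻¹ * N ≤ e / 2 := by
    rw [inv_mul_le_iff₀ (by positivity)]
    nlinarith
  have h2 : (2 * D + 4)⁻¹ * (G + β * J) ≤ e / 2 + J / 2 + β * J / 4 := by
    rw [inv_mul_le_iff₀ (by positivity)]
    have : 0 ≤ β * J := mul_nonneg (by linarith) hJv
    nlinarith [mul_nonneg hD0 this]
  have h3 : 8 * (C + 1) * J ≤ β * J := mul_le_mul_of_nonneg_right hβ hJv
  have h4 : 0 ≤ C * J := mul_nonneg hC0 hJv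
  nlinarith

end Mesh

end Biot

namespace Biot

open Set

/-! ### Linear differential equations with constant coefficients -/

section LinearODE

variable {F : Type*} [NormedAddCommGroup F] [NormedSpace ℝ F] [CompleteSpace F]

theorem exp_smul_mul_exp_smul_neg (A : F →L[ℝ] F) (t : ℝ) :
    NormedSpace.exp (t • A) * NormedSpace.exp (t • (-A)) = 1 := by
  have hc : Commute (t • A) (t • (-A)) := by
    simp [Commute, SemiconjBy]
  have : NormedAlgebra ℚ (F →L[ℝ] F) := NormedAlgebra.restrictScalars ℚ ℝ _
  rw [← NormedSpace.exp_add_of_commute hc]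
  simp

/-- Variation of constants: y(t) = exp(tA)(y₀ + ∫₀ᵗ exp(-sA) b(s) ds). Freezing b at b(0) for
negative times makes the integrand continuous on the whole line. -/
theorem exists_hasDerivAt_linear (A : F →L[ℝ] F) {b : ℝ → F} (hb : ContinuousOn b (Ici 0))
    (y₀ : F) : ∃ y : ℝ → F, Continuous y ∧ y 0 = y₀ ∧
      ∀ t > 0, HasDerivAt y (A (y t) + b t) t := by
  have hb' : Continuous fun t => b (max t 0) :=
    hb.comp_continuous (by fun_prop) fun t => le_max_right t 0
  have hexp : ∀ (A : F →L[ℝ] F) (t : ℝ), HasDerivAt (fun s : ℝ => NormedSpace.exp (s • A))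
      (A * NormedSpace.exp (t • A)) t := fun A t => hasDerivAt_exp_smul_const' A t
  have hcont : Continuous fun s : ℝ => NormedSpace.exp (s • (-A)) (b (max s 0)) := by
    have : Continuous fun s : ℝ => NormedSpace.exp (s • (-A)) :=
      continuous_iff_continuousAt.2 fun t => (hexp (-A) t).continuousAt
    exact this.clm_apply hb'
  have hder : ∀ t, HasDerivAt (fun t : ℝ => NormedSpace.exp (t • A)
      (y₀ + ∫ s in (0 : ℝ)..t, NormedSpace.exp (s • (-A)) (b (max s 0))))
      (A (NormedSpace.exp (t • A)
        (y₀ + ∫ s in (0 : ℝ)..t, NormedSpace.exp (s • (-A)) (b (max s 0)))) + b (max t 0)) t := by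
    intro t
    have h1 := (hcont.integral_hasStrictDerivAt 0 t).hasDerivAt
    have h2 := (hexp A t).clm_apply (h1.const_add y₀)
    have h3 := congrArg (fun f : F →L[ℝ] F => f (b (max t 0))) (exp_smul_mul_exp_smul_neg A t)
    simp only [mul_apply_eq_comp, one_apply_eq_self] at h3
    rw [h3] at h2
    exact h2
  refine ⟨_, continuous_iff_continuousAt.2 fun t => (hder t).continuousAt, ?_, fun t ht => ?_⟩
  · simp
  · have h := hder t
    rwa [max_eq_left (le_of_lt ht)] at h

/-- The curve exp(-sA) y(s) has derivative zero for s > 0 and is continuous up to s = 0, hence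
constant. -/
theorem eq_zero_of_hasDerivAt_linear (A : F →L[ℝ] F) {y : ℝ → F} (hy : ContinuousOn y (Ici 0))
    (h0 : y 0 = 0) (hder : ∀ t > 0, HasDerivAt y (A (y t)) t) : ∀ t ≥ 0, y t = 0 := by
  intro t ht
  have hexp : ∀ t : ℝ, HasDerivAt (fun s : ℝ => NormedSpace.exp (s • (-A)))
      (NormedSpace.exp (t • (-A)) * (-A)) t := fun t => hasDerivAt_exp_smul_const (-A) t
  have hc : Continuous fun s : ℝ => NormedSpace.exp (s • (-A)) :=
    continuous_iff_continuousAt.2 fun t => (hexp t).continuousAt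
  have hincl := intervalIntegral.integral_eq_sub_of_hasDerivAt_of_le
    (f := fun s : ℝ => NormedSpace.exp (s • (-A)) (y s)) (f' := fun _ => 0) ht
    (hc.continuousOn.clm_apply (hy.mono Icc_subset_Ici_self)) (fun s hs => by
      have h := (hexp s).clm_apply (hder s hs.1)
      simpa using h) (by simp)
  simp only [intervalIntegral.integral_zero, h0, map_zero, sub_zero] at hincl
  have hinv := congrArg (fun f : F →L[ℝ] F => f (y t)) (exp_smul_mul_exp_smul_neg A t)
  simp only [mul_apply_eq_comp, one_apply_eq_self] at hinv
  rw [← hinv, ← hincl, map_zero]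

end LinearODE

/-! ### Curves described by linear coordinates -/

section Curves

variable {X Y : Type*} [AddCommGroup X] [Module ℝ X] [AddCommGroup Y] [Module ℝ Y]

/-- A curve that is continuous for `t ≥ 0`, coordinate by coordinate. -/
def ContinuousCurve (y : ℝ → X) : Prop :=
  ∀ l : Module.Dual ℝ X, ContinuousOn (fun t => l (y t)) (Ici 0)

/-- The curve `y` has the derivative `y'` at time `t`, coordinate by coordinate. -/
def HasCurveDerivAt (y : ℝ → X) (y' : X) (t : ℝ) : Prop :=
  ∀ l : Module.Dual ℝ X, HasDerivAt (fun s => l (y s)) (l y') t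

namespace ContinuousCurve

theorem add {y z : ℝ → X} (hy : ContinuousCurve y) (hz : ContinuousCurve z) :
    ContinuousCurve fun t => y t + z t := fun l => by
  simpa [Pi.add_def] using (hy l).add (hz l)

theorem sub {y z : ℝ → X} (hy : ContinuousCurve y) (hz : ContinuousCurve z) :
    ContinuousCurve fun t => y t - z t := fun l => by
  simpa [Pi.sub_def] using (hy l).sub (hz l)

theorem map {y : ℝ → X} (hy : ContinuousCurve y) (f : X →ₗ[ℝ] Y) :
    ContinuousCurve fun t => f (y t) := fun l => hy (l ∘ₗ f)

theorem of_dual [FiniteDimensional ℝ X] {y : ℝ → Module.Dual ℝ X}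
    (hy : ∀ x, ContinuousOn (fun t => y t x) (Ici 0)) : ContinuousCurve y := fun l => by
  obtain ⟨x, rfl⟩ := (Module.evalEquiv ℝ X).surjective l
  exact hy x

/-- Continuous curves that agree for positive times agree at time zero. -/
theorem eq_zero_time {y z : ℝ → X} (hy : ContinuousCurve y) (hz : ContinuousCurve z)
    (h : ∀ t > 0, y t = z t) : y 0 = z 0 := by
  refine sub_eq_zero.1 ((Module.forall_dual_apply_eq_zero_iff ℝ _).1 fun l => ?_)
  have hcont := ((hy.sub hz) l 0 self_mem_Ici).mono Ioi_subset_Ici_self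
  refine tendsto_nhds_unique hcont.tendsto (tendsto_const_nhds.congr' ?_)
  filter_upwards [self_mem_nhdsWithin] with t ht
  rw [h t ht, sub_self, map_zero]

end ContinuousCurve

theorem HasCurveDerivAt.of_dual [FiniteDimensional ℝ X] {y : ℝ → Module.Dual ℝ X}
    {y' : Module.Dual ℝ X} {t : ℝ} (h : ∀ x, HasDerivAt (fun s => y s x) (y' x) t) :
    HasCurveDerivAt y y' t := fun l => by
  obtain ⟨x, rfl⟩ := (Module.evalEquiv ℝ X).surjective l
  exact h x

variable [FiniteDimensional ℝ X]

theorem exists_linear_ode (A : X →ₗ[ℝ] X) {b : ℝ → X} (hb : ContinuousCurve b) (y₀ : X) :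
    ∃ y : ℝ → X, ContinuousCurve y ∧ y 0 = y₀ ∧
      ∀ t > 0, HasCurveDerivAt y (A (y t) + b t) t := by
  let e := (Module.finBasis ℝ X).equivFun
  have hb' : ContinuousOn (fun t => e (b t)) (Ici 0) :=
    continuousOn_pi.2 fun i => hb ((LinearMap.proj i) ∘ₗ e.toLinearMap)
  obtain ⟨z, hz, hz0, hder⟩ := exists_hasDerivAt_linear
    (LinearMap.toContinuousLinearMap (e.toLinearMap ∘ₗ A ∘ₗ e.symm.toLinearMap)) hb' (e y₀)
  refine ⟨fun t => e.symm (z t), fun l => ?_, by simp [hz0], fun t ht l => ?_⟩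
  · exact ((LinearMap.toContinuousLinearMap (l ∘ₗ e.symm.toLinearMap)).continuous.comp
      hz).continuousOn
  · have h := (LinearMap.toContinuousLinearMap
      (l ∘ₗ e.symm.toLinearMap)).hasFDerivAt.comp_hasDerivAt t (hder t ht)
    simpa [Function.comp_def] using h

theorem eq_of_linear_ode (A : X →ₗ[ℝ] X) {b y z : ℝ → X} (hy : ContinuousCurve y)
    (hz : ContinuousCurve z) (h0 : y 0 = z 0)
    (hyd : ∀ t > 0, HasCurveDerivAt y (A (y t) + b t) t)
    (hzd : ∀ t > 0, HasCurveDerivAt z (A (z t) + b t) t) : ∀ t ≥ 0, y t = z t := by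
  let e := (Module.finBasis ℝ X).equivFun
  have h := eq_zero_of_hasDerivAt_linear
    (LinearMap.toContinuousLinearMap (e.toLinearMap ∘ₗ A ∘ₗ e.symm.toLinearMap))
    (y := fun t => e (y t - z t))
    (continuousOn_pi.2 fun i => (hy.sub hz) ((LinearMap.proj i) ∘ₗ e.toLinearMap))
    (by simp [h0]) fun t ht => hasDerivAt_pi.2 fun i => by
      have h1 := (hyd t ht ((LinearMap.proj i) ∘ₗ e.toLinearMap)).sub
        (hzd t ht ((LinearMap.proj i) ∘ₗ e.toLinearMap))
      simp only [LinearMap.coe_toContinuousLinearMap', LinearMap.comp_apply, LinearEquiv.coe_coe,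
        LinearEquiv.symm_apply_apply, map_sub, Pi.sub_apply]
      simpa [Pi.sub_def] using h1
  intro t ht
  have := h t ht
  rw [map_eq_zero_iff e e.injective] at this
  exact sub_eq_zero.1 this

end Curves

/-! ### The abstract Biot system -/

/-- Positivity makes `P` injective into the dual, which has the same dimension; symmetry plays no
part. -/
theorem exists_riesz {X : Type*} [AddCommGroup X] [Module ℝ X] [FiniteDimensional ℝ X]
    (P : X →ₗ[ℝ] X →ₗ[ℝ] ℝ) (hP : ∀ x ≠ 0, 0 < P x x) :
    ∃ R : Module.Dual ℝ X ≃ₗ[ℝ] X, (∀ l, P (R l) = l) ∧ ∀ x l, P x = l ↔ x = R l := by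
  have hinj : Function.Injective P := by
    rw [injective_iff_map_eq_zero]
    intro x hx
    by_contra h0
    have := hP x h0
    simp [hx] at this
  let e : X ≃ₗ[ℝ] Module.Dual ℝ X :=
    LinearEquiv.ofInjectiveOfFinrankEq P hinj (Subspace.dual_finrank_eq).symm
  exact ⟨e.symm, fun l => e.apply_symm_apply l, fun x l => (e.eq_symm_apply).symm⟩

/-- The data of the discrete Biot system: the inner product of the pressure space, the
permeability form, the elasticity form, the two divergence operators and the coefficients. -/
structure System (Q W V : Type*) [AddCommGroup Q] [Module ℝ Q] [AddCommGroup W] [Module ℝ W]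
    [AddCommGroup V] [Module ℝ V] where
  /-- the inner product of the pressure space -/
  m : Q →ₗ[ℝ] Q →ₗ[ℝ] ℝ
  /-- the permeability form -/
  k : W →ₗ[ℝ] W →ₗ[ℝ] ℝ
  /-- the elasticity form -/
  a : V →ₗ[ℝ] V →ₗ[ℝ] ℝ
  /-- the divergence of velocities -/
  divW : W →ₗ[ℝ] Q
  /-- the divergence of displacements -/
  divV : V →ₗ[ℝ] Q
  /-- the storage coefficient -/
  cs : ℝ
  /-- the coupling coefficient -/
  al : ℝ
  m_symm : ∀ p q, m p q = m q p
  m_pos : ∀ q ≠ 0, 0 < m q q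
  k_pos : ∀ w ≠ 0, 0 < k w w
  a_pos : ∀ v ≠ 0, 0 < a v v
  divW_surjective : Function.Surjective divW
  divV_surjective : Function.Surjective divV
  cs_nonneg : 0 ≤ cs

namespace System

variable {Q W V : Type*} [AddCommGroup Q] [Module ℝ Q] [AddCommGroup W] [Module ℝ W]
  [AddCommGroup V] [Module ℝ V] (S : System Q W V)

theorem nonneg_of_pos {X : Type*} [AddCommGroup X] [Module ℝ X] {P : X →ₗ[ℝ] X →ₗ[ℝ] ℝ}
    (hP : ∀ x ≠ 0, 0 < P x x) (x : X) : 0 ≤ P x x := by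
  by_cases h : x = 0
  · simp [h]
  · exact (hP x h).le

theorem eq_zero_of_pos {X : Type*} [AddCommGroup X] [Module ℝ X] {P : X →ₗ[ℝ] X →ₗ[ℝ] ℝ}
    (hP : ∀ x ≠ 0, 0 < P x x) {x : X} (h : P x x = 0) : x = 0 := by
  by_contra h0
  exact (hP x h0).ne' h

theorem eq_zero_of_forall_divW {p : Q} (h : ∀ z, S.m p (S.divW z) = 0) : p = 0 := by
  obtain ⟨z, hz⟩ := S.divW_surjective p
  have := h z
  rw [hz] at this
  exact eq_zero_of_pos S.m_pos this

theorem eq_zero_of_forall_divV {p : Q} (h : ∀ v, S.m p (S.divV v) = 0) : p = 0 := by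
  obtain ⟨z, hz⟩ := S.divV_surjective p
  have := h z
  rw [hz] at this
  exact eq_zero_of_pos S.m_pos this

/-- The homogeneous system has only the trivial solution. -/
theorem homogeneous_eq_zero {σ : ℝ} (hσ : 0 < σ) {p : Q} {w : W} {u : V}
    (mass : ∀ q, σ * (S.cs * S.m p q + S.al * S.m (S.divV u) q) + S.m (S.divW w) q = 0)
    (darcy : ∀ z, S.k w z - S.m p (S.divW z) = 0)
    (elasticity : ∀ v, S.a u v - S.al * S.m p (S.divV v) = 0) : p = 0 ∧ w = 0 ∧ u = 0 := by
  have h1 := mass p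
  have h2 := darcy w
  have h3 := elasticity u
  rw [S.m_symm p (S.divW w)] at h2
  rw [S.m_symm p (S.divV u)] at h3
  have hm := nonneg_of_pos S.m_pos p
  have hk := nonneg_of_pos S.k_pos w
  have ha := nonneg_of_pos S.a_pos u
  have hsum : σ * (S.cs * S.m p p) + σ * S.a u u + S.k w w = 0 := by
    linear_combination h1 + h2 + σ * h3
  have hc : 0 ≤ σ * (S.cs * S.m p p) := mul_nonneg hσ.le (mul_nonneg S.cs_nonneg hm)
  have hau : 0 ≤ σ * S.a u u := mul_nonneg hσ.le ha
  have hw : w = 0 := eq_zero_of_pos S.k_pos (by linarith)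
  have hu : u = 0 := eq_zero_of_pos S.a_pos
    ((mul_eq_zero.1 (by linarith : σ * S.a u u = 0)).resolve_left hσ.ne')
  -- Since `cs` may vanish, the energy need not control p; Darcy's equation and surjectivity of the
  -- divergence do.
  refine ⟨S.eq_zero_of_forall_divW fun z => ?_, hw, hu⟩
  have := darcy z
  rw [hw] at this
  simpa using this

/-- Solutions of the semi-discrete system. -/
structure IsSolution (f : ℝ → Module.Dual ℝ Q) (g : ℝ → Module.Dual ℝ W)
    (r : ℝ → Module.Dual ℝ V) (p : ℝ → Q) (w : ℝ → W) (u : ℝ → V) : Prop where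
  continuous_p : ContinuousCurve p
  continuous_w : ContinuousCurve w
  continuous_u : ContinuousCurve u
  mass : ∀ t > 0, ∀ q, HasDerivAt (fun s => S.cs * S.m (p s) q + S.al * S.m (S.divV (u s)) q)
    (f t q - S.m (S.divW (w t)) q) t
  darcy : ∀ t > 0, ∀ z, S.k (w t) z - S.m (p t) (S.divW z) = g t z
  elasticity : ∀ t > 0, ∀ v, S.a (u t) v - S.al * S.m (p t) (S.divV v) = r t v

variable [FiniteDimensional ℝ Q] [FiniteDimensional ℝ W] [FiniteDimensional ℝ V]

/-- Elimination of velocity and displacement. The functional `η = c_s p + α div u` determines the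
pressure. -/
theorem exists_elimination (h : S.al ≠ 0 ∨ 0 < S.cs) :
    ∃ (Rk : Module.Dual ℝ W →ₗ[ℝ] W) (Ra : Module.Dual ℝ V →ₗ[ℝ] V)
      (Rs : Module.Dual ℝ Q →ₗ[ℝ] Q),
      (∀ w p g, (∀ z, S.k w z - S.m p (S.divW z) = g z) ↔ w = Rk (g + S.m p ∘ₗ S.divW)) ∧
      (∀ u p r, (∀ v, S.a u v - S.al * S.m p (S.divV v) = r v) ↔
        u = Ra (r + S.al • S.m p ∘ₗ S.divV)) ∧
      ∀ p r η, S.cs • S.m p + S.al • S.m (S.divV (Ra (r + S.al • S.m p ∘ₗ S.divV))) = η ↔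
        p = Rs (η - S.al • S.m (S.divV (Ra r))) := by
  obtain ⟨Rk, -, hRk⟩ := exists_riesz S.k S.k_pos
  obtain ⟨Ra, hRa, hRa'⟩ := exists_riesz S.a S.a_pos
  let adj : Q →ₗ[ℝ] Module.Dual ℝ V := S.al • (S.m.compl₂ S.divV)
  have hadj : ∀ p, adj p = S.al • S.m p ∘ₗ S.divV := fun p => rfl
  -- The Schur complement left on pressures when the displacement is eliminated.
  let s : Q →ₗ[ℝ] Q →ₗ[ℝ] ℝ := S.cs • S.m + S.al • (S.m ∘ₗ S.divV ∘ₗ Ra.toLinearMap ∘ₗ adj)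
  have hs : ∀ p, s p = S.cs • S.m p + S.al • S.m (S.divV (Ra (adj p))) := fun p => rfl
  have hsp : ∀ p, s p p = S.cs * S.m p p + S.a (Ra (adj p)) (Ra (adj p)) := by
    intro p
    have h1 : S.a (Ra (adj p)) (Ra (adj p)) = S.al * S.m p (S.divV (Ra (adj p))) := by
      rw [hRa (adj p)]
      rfl
    rw [h1, hs, S.m_symm p (S.divV _)]
    rfl
  have hspos : ∀ p ≠ 0, 0 < s p p := by
    intro p hp
    rw [hsp]
    have h1 := nonneg_of_pos S.a_pos (Ra (adj p))
    have h2 := S.m_pos p hp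
    -- For `al ≠ 0`, `adj` is injective because displacements have arbitrary divergence in `Q`, so
    -- the elastic energy is positive.
    rcases h with h | h
    · have h3 : Ra (adj p) ≠ 0 := by
        intro h0
        rw [Ra.map_eq_zero_iff] at h0
        refine hp (S.eq_zero_of_forall_divV fun v => ?_)
        have := congrArg (fun l => l v) h0
        exact (mul_eq_zero.1 this).resolve_left h
      have := S.a_pos _ h3
      have := mul_nonneg S.cs_nonneg h2.le
      linarith
    · have := mul_pos h h2
      linarith
  obtain ⟨Rs, -, hRs⟩ := exists_riesz s hspos
  refine ⟨Rk.toLinearMap, Ra.toLinearMap, Rs.toLinearMap, fun w p g => ?_, fun u p r => ?_,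
    fun p r η => ?_⟩
  · rw [LinearEquiv.coe_coe, ← hRk, LinearMap.ext_iff]
    exact forall_congr' fun z => sub_eq_iff_eq_add
  · rw [LinearEquiv.coe_coe, ← hRa', LinearMap.ext_iff]
    exact forall_congr' fun z => sub_eq_iff_eq_add
  · simp only [LinearEquiv.coe_coe]
    rw [← hRs, hs, hadj, map_add, map_add, map_add, smul_add, eq_sub_iff_add_eq]
    constructor <;> intro h <;> rw [← h] <;> abel

/-- Unique solvability of the semi-discrete system. -/
theorem existsUnique_solution (h : S.al ≠ 0 ∨ 0 < S.cs) {f : ℝ → Module.Dual ℝ Q}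
    {g : ℝ → Module.Dual ℝ W} {r : ℝ → Module.Dual ℝ V} (hf : ContinuousCurve f)
    (hg : ContinuousCurve g) (hr : ContinuousCurve r) (p₀ : Q) (u₀ : V)
    (h₀ : ∀ v, S.a u₀ v - S.al * S.m p₀ (S.divV v) = r 0 v) :
    ∃ (p : ℝ → Q) (w : ℝ → W) (u : ℝ → V), (S.IsSolution f g r p w u ∧ p 0 = p₀ ∧ u 0 = u₀) ∧
      ∀ (p' : ℝ → Q) (w' : ℝ → W) (u' : ℝ → V), S.IsSolution f g r p' w' u' → p' 0 = p₀ →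
        u' 0 = u₀ → ∀ t ≥ 0, p' t = p t ∧ w' t = w t ∧ u' t = u t := by
  obtain ⟨Rk, Ra, Rs, hRk, hRa, hRs⟩ := S.exists_elimination h
  let DW : Q →ₗ[ℝ] Module.Dual ℝ W := S.m.compl₂ S.divW
  let DV : Q →ₗ[ℝ] Module.Dual ℝ V := S.al • (S.m.compl₂ S.divV)
  let ηu : V →ₗ[ℝ] Module.Dual ℝ Q := S.al • (S.m ∘ₗ S.divV)
  let ηw : W →ₗ[ℝ] Module.Dual ℝ Q := S.m ∘ₗ S.divW
  -- With p and w expressed through η, the mass equation reads η' = A η + b.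
  let A : Module.Dual ℝ Q →ₗ[ℝ] Module.Dual ℝ Q := -(ηw ∘ₗ Rk ∘ₗ DW ∘ₗ Rs)
  let b : ℝ → Module.Dual ℝ Q := fun t => f t - ηw (Rk (g t - DW (Rs (ηu (Ra (r t))))))
  have hb : ContinuousCurve b := by
    refine hf.sub ?_
    exact ((hg.sub (hr.map (DW ∘ₗ Rs ∘ₗ ηu ∘ₗ Ra))).map (ηw ∘ₗ Rk))
  have hAb : ∀ (t : ℝ) (η : Module.Dual ℝ Q),
      A η + b t = f t - ηw (Rk (g t + DW (Rs (η - ηu (Ra (r t)))))) := by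
    intro t η
    simp only [A, b, LinearMap.neg_apply, LinearMap.comp_apply, map_sub, map_add]
    abel
  obtain ⟨η, hη, hη0, hηd⟩ := exists_linear_ode A hb (S.cs • S.m p₀ + ηu u₀)
  let p : ℝ → Q := fun t => Rs (η t - ηu (Ra (r t)))
  let w : ℝ → W := fun t => Rk (g t + DW (p t))
  let u : ℝ → V := fun t => Ra (r t + DV (p t))
  have hp : ContinuousCurve p := (hη.sub (hr.map (ηu ∘ₗ Ra))).map Rs
  have hw : ContinuousCurve w := (hg.add (hp.map DW)).map Rk
  have hu : ContinuousCurve u := (hr.add (hp.map DV)).map Ra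
  have hηeq : ∀ t, S.cs • S.m (p t) + ηu (u t) = η t := fun t => (hRs (p t) (r t) (η t)).2 rfl
  -- Compatibility makes u₀ the displacement that belongs to p₀, so the initial η gives back both.
  have hu₀ : u₀ = Ra (r 0 + DV p₀) := (hRa u₀ p₀ (r 0)).1 h₀
  have hp0 : p 0 = p₀ := by
    refine ((hRs p₀ (r 0) (η 0)).1 ?_).symm
    rw [hη0, hu₀]
    rfl
  refine ⟨p, w, u, ⟨⟨hp, hw, hu, fun t ht q => ?_, fun t _ => (hRk _ _ _).2 rfl,
    fun t _ => (hRa _ _ _).2 rfl⟩, hp0, ?_⟩, ?_⟩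
  · have hd := hηd t ht (Module.Dual.eval ℝ Q q)
    rw [hAb] at hd
    have hfun : (fun s => Module.Dual.eval ℝ Q q (η s)) =
        fun s => S.cs * S.m (p s) q + S.al * S.m (S.divV (u s)) q := by
      funext s
      rw [← hηeq s]
      rfl
    rw [hfun] at hd
    exact hd
  · change Ra (r 0 + DV (p 0)) = u₀
    rw [hp0, hu₀]
  · intro p' w' u' hsol hp'0 hu'0
    let η' : ℝ → Module.Dual ℝ Q := fun t => S.cs • S.m (p' t) + ηu (u' t)
    have hη' : ContinuousCurve η' := (hsol.continuous_p.map (S.cs • S.m)).add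
      (hsol.continuous_u.map ηu)
    have hu' : ∀ t > 0, u' t = Ra (r t + DV (p' t)) := fun t ht =>
      (hRa _ _ _).1 (hsol.elasticity t ht)
    have hp' : ∀ t > 0, p' t = Rs (η' t - ηu (Ra (r t))) := fun t ht => by
      refine (hRs (p' t) (r t) (η' t)).1 ?_
      change _ = S.cs • S.m (p' t) + ηu (u' t)
      rw [hu' t ht]
      rfl
    have hw' : ∀ t > 0, w' t = Rk (g t + DW (p' t)) := fun t ht =>
      (hRk _ _ _).1 (hsol.darcy t ht)
    have hη'd : ∀ t > 0, HasCurveDerivAt η' (A (η' t) + b t) t := by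
      intro t ht
      rw [hAb, ← hp' t ht, ← hw' t ht]
      exact .of_dual fun q => hsol.mass t ht q
    have heq := eq_of_linear_ode A hη' hη (by rw [hη0, ← hp'0, ← hu'0]) hη'd hηd
    have hpos : ∀ t > 0, p' t = p t ∧ w' t = w t ∧ u' t = u t := by
      intro t ht
      have h1 : p' t = p t := by rw [hp' t ht, heq t (le_of_lt ht)]
      exact ⟨h1, by rw [hw' t ht, h1], by rw [hu' t ht, h1]⟩
    intro t ht
    -- The equations hold for t > 0 only; agreement at time zero follows by continuity.
    rcases (show (0 : ℝ) ≤ t from ht).eq_or_lt with rfl | ht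
    · exact ⟨hsol.continuous_p.eq_zero_time hp fun t ht => (hpos t ht).1,
        hsol.continuous_w.eq_zero_time hw fun t ht => (hpos t ht).2.1,
        hsol.continuous_u.eq_zero_time hu fun t ht => (hpos t ht).2.2⟩
    · exact hpos t ht

end System

end Biot

namespace Biot

open MeasureTheory

namespace Mesh

variable {d : ℕ} {ι I B : Type*}

/-! ### The discrete Biot system -/

/-- The divergence as a map between subspaces. -/
noncomputable def divRestrict (W : Submodule ℝ (Vect d ι)) (Q : Submodule ℝ (Scal d ι))
    (h : W.map (divB d ι) = Q) : W →ₗ[ℝ] Q :=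
  ((divB d ι).domRestrict W).codRestrict Q fun w => h ▸ Submodule.mem_map_of_mem w.2

theorem divRestrict_surjective {W : Submodule ℝ (Vect d ι)} {Q : Submodule ℝ (Scal d ι)}
    (h : W.map (divB d ι) = Q) : Function.Surjective (divRestrict W Q h) := by
  rintro ⟨q, hq⟩
  rw [← h] at hq
  obtain ⟨w, hw, rfl⟩ := hq
  exact ⟨⟨w, hw⟩, rfl⟩

variable [Fintype ι]

/-- The `L²` inner product of piecewise polynomial functions. -/
noncomputable def massForm (M : Mesh d ι I B) (hd : 2 ≤ d) : Scal d ι →ₗ[ℝ] Scal d ι →ₗ[ℝ] ℝ :=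
  ∑ T, (M.isThick_elem hd T).form (LinearMap.proj T) (LinearMap.proj T)

theorem innerS_eq (M : Mesh d ι I B) (hd : 2 ≤ d) (p q : Scal d ι) :
    M.innerS p q = M.massForm hd p q := by
  simp [innerS, massForm, LinearMap.sum_apply, IsThick.integral_apply]

theorem isSymmNonneg_massForm (M : Mesh d ι I B) (hd : 2 ≤ d) : IsSymmNonneg (M.massForm hd) :=
  .sum fun _ _ => IsThick.form_self _ _

theorem massForm_pos (M : Mesh d ι I B) (hd : 2 ≤ d) {p : Scal d ι} (hp : p ≠ 0) :
    0 < M.massForm hd p p := by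
  refine ((M.isSymmNonneg_massForm hd).nonneg p).lt_of_ne' fun h => hp ?_
  rw [massForm, LinearMap.sum_apply, LinearMap.sum_apply,
    Finset.sum_eq_zero_iff_of_nonneg fun T _ => (IsThick.form_self _ _).nonneg p] at h
  funext T
  exact eq_zero_of_val_eq_zero (M.isBody hd T).nonempty_interior
    (IsThick.val_eq_zero_of_form _ (h T (Finset.mem_univ T)))

/-- The form `(A w, z)`. -/
noncomputable def matrixForm (M : Mesh d ι I B) (hd : 2 ≤ d) (A : Matrix (Fin d) (Fin d) ℝ) :
    Vect d ι →ₗ[ℝ] Vect d ι →ₗ[ℝ] ℝ :=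
  ∑ T, ∑ i, (M.isThick_elem hd T).form (∑ j, A i j • compL T j) (compL T i)

theorem innerV_eq (M : Mesh d ι I B) (hd : 2 ≤ d) (A : Matrix (Fin d) (Fin d) ℝ)
    (w z : Vect d ι) : M.innerV A w z = M.matrixForm hd A w z := by
  simp only [innerV, matrixForm, LinearMap.sum_apply, IsThick.form_apply]
  simp only [← map_sum]
  simp only [IsThick.integral_apply, val_sum, val_mul, val_smul, val_compL,
    LinearMap.smul_apply]

theorem matrixForm_pos (M : Mesh d ι I B) (hd : 2 ≤ d) {A : Matrix (Fin d) (Fin d) ℝ}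
    (hA : A.PosDef) {w : Vect d ι} (hw : w ≠ 0) : 0 < M.matrixForm hd A w w := by
  let f : ι → MvPolynomial (Fin d) ℝ := fun T =>
    ∑ i, (∑ j, A i j • compL T j) w * compL T i w
  have hval : ∀ T x, val (f T) x =
      star (fun i => val (w T i) x) ⬝ᵥ A.mulVec fun i => val (w T i) x := by
    intro T x
    simp [f, dotProduct, Matrix.mulVec, LinearMap.sum_apply, mul_comm]
  have hnn : ∀ T x, 0 ≤ val (f T) x := fun T x => by
    rw [hval]
    exact hA.posSemidef.dotProduct_mulVec_nonneg _
  have heq : M.matrixForm hd A w w = ∑ T, (M.isThick_elem hd T).integral (f T) := by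
    simp only [matrixForm, LinearMap.sum_apply, IsThick.form_apply, f, map_sum]
  rw [heq]
  have hnn' : ∀ T ∈ Finset.univ, 0 ≤ (M.isThick_elem hd T).integral (f T) :=
    fun T _ => IsThick.integral_nonneg _ (hnn T)
  refine (Finset.sum_nonneg hnn').lt_of_ne' fun h => hw ?_
  rw [Finset.sum_eq_zero_iff_of_nonneg hnn'] at h
  funext T i
  refine eq_zero_of_val_eq_zero (M.isBody hd T).nonempty_interior fun x hx => ?_
  have h0 := IsThick.val_eq_zero_of_integral_eq_zero _ (hnn T) (h T (Finset.mem_univ T)) x hx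
  rw [hval] at h0
  by_contra hne
  exact (hA.dotProduct_mulVec_pos (x := fun i => val (w T i) x)
    fun hz => hne (congrFun hz i)).ne' h0

variable [Fintype I]

/-- The form `a_h`. -/
noncomputable def elasticityForm (M : Mesh d ι I B) (hd : 2 ≤ d) (Γ : Finset B) (γ : ℝ)
    (c : Coefficients d) : Vect d ι →ₗ[ℝ] Vect d ι →ₗ[ℝ] ℝ :=
  c.mu • ((2 : ℝ) • M.strainForm hd + (γ / M.size) • M.jumpForm hd Γ
    - (2 : ℝ) • M.consistencyForm hd Γ - (2 : ℝ) • (M.consistencyForm hd Γ).flip)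
    + c.lam • (M.massForm hd).compl₁₂ (divB d ι) (divB d ι)

theorem aForm_eq (M : Mesh d ι I B) (hd : 2 ≤ d) (Γ : Finset B) (γ : ℝ) (c : Coefficients d)
    (u v : Vect d ι) : M.aForm Γ γ c u v = M.elasticityForm hd Γ γ c u v := by
  simp [aForm, elasticityForm, M.dForm_eq hd, M.innerS_eq hd]

/-- Coercivity bounds the form below by the mesh norm, which is definite on a connected domain with
a Dirichlet face. -/
theorem elasticityForm_pos (M : Mesh d ι I B) (hd : 2 ≤ d) (hΩ : IsConnected M.domain)
    {Γ : Finset B} (hΓ : Γ.Nonempty) {γ : ℝ} (hγ : 0 < γ) {V : Submodule ℝ (Vect d ι)}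
    (hV : M.Coercive Γ γ V) {c : Coefficients d} (hmu : 0 < c.mu) (hlam : 0 ≤ c.lam)
    {v : Vect d ι} (hv : v ∈ V) (hv0 : v ≠ 0) : 0 < M.elasticityForm hd Γ γ c v v := by
  obtain ⟨κ, hκ, hcoer⟩ := hV
  rw [← M.aForm_eq hd, aForm, M.innerS_eq hd]
  have h1 : 0 < M.normSq Γ γ v := (M.normSq_nonneg hd hγ.le v).lt_of_ne' fun h =>
    hv0 (M.eq_zero_of_normSq_eq_zero hd hΩ hΓ hγ h)
  have h2 : 0 < M.dForm Γ γ v v := (mul_pos hκ h1).trans_le (hcoer v hv)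
  exact add_pos_of_pos_of_nonneg (mul_pos hmu h2)
    (mul_nonneg hlam ((M.isSymmNonneg_massForm hd).nonneg _))

/-- The hypotheses on mesh, spaces and coefficients under which the discrete system is
well-posed. -/
structure IsStable (M : Mesh d ι I B) (Γ : Finset B) (γ : ℝ) (c : Coefficients d)
    (Q : Submodule ℝ (Scal d ι)) (W V : Submodule ℝ (Vect d ι)) : Prop where
  two_le : 2 ≤ d
  isConnected : IsConnected M.domain
  nonempty : Γ.Nonempty
  map_divW : W.map (divB d ι) = Q
  map_divV : V.map (divB d ι) = Q
  penalty_pos : 0 < γ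
  coercive : M.Coercive Γ γ V
  mu_pos : 0 < c.mu
  lam_nonneg : 0 ≤ c.lam
  cs_nonneg : 0 ≤ c.cs
  posDef : c.K.PosDef

namespace IsStable

variable {M : Mesh d ι I B} {Γ : Finset B} {γ : ℝ} {c : Coefficients d}
  {Q : Submodule ℝ (Scal d ι)} {W V : Submodule ℝ (Vect d ι)}

/-- The discrete Biot system in abstract form. -/
noncomputable def system (h : M.IsStable Γ γ c Q W V) : System Q W V where
  m := (M.massForm h.two_le).compl₁₂ Q.subtype Q.subtype
  k := (M.matrixForm h.two_le c.K⁻¹).compl₁₂ W.subtype W.subtype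
  a := (M.elasticityForm h.two_le Γ γ c).compl₁₂ V.subtype V.subtype
  divW := divRestrict W Q h.map_divW
  divV := divRestrict V Q h.map_divV
  cs := c.cs
  al := c.alpha
  m_symm := fun p q => (M.isSymmNonneg_massForm h.two_le).symm p q
  m_pos := fun q hq => M.massForm_pos h.two_le (by simpa using hq)
  k_pos := fun w hw => M.matrixForm_pos h.two_le h.posDef.inv (by simpa using hw)
  a_pos := fun v hv => M.elasticityForm_pos h.two_le h.isConnected h.nonempty h.penalty_pos
    h.coercive h.mu_pos h.lam_nonneg v.2 (by simpa using hv)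
  divW_surjective := divRestrict_surjective h.map_divW
  divV_surjective := divRestrict_surjective h.map_divV
  cs_nonneg := h.cs_nonneg

theorem system_mass (h : M.IsStable Γ γ c Q W V) (p : Q) (u : V) (q : Q) :
    M.innerS (c.cs • (p : Scal d ι) + c.alpha • divB d ι u) q =
      h.system.cs * h.system.m p q + h.system.al * h.system.m (h.system.divV u) q := by
  rw [M.innerS_eq h.two_le, map_add, map_smul, map_smul]
  rfl

theorem system_darcy (h : M.IsStable Γ γ c Q W V) (w : W) (p : Q) (z : W) :
    M.innerV c.K⁻¹ w z - M.innerS p (divB d ι z) =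
      h.system.k w z - h.system.m p (h.system.divW z) := by
  rw [M.innerV_eq h.two_le, M.innerS_eq h.two_le]
  rfl

theorem system_elasticity (h : M.IsStable Γ γ c Q W V) (u : V) (p : Q) (v : V) :
    M.aForm Γ γ c u v - c.alpha * M.innerS p (divB d ι v) =
      h.system.a u v - h.system.al * h.system.m p (h.system.divV v) := by
  rw [M.aForm_eq h.two_le, M.innerS_eq h.two_le]
  rfl

theorem isSemidiscreteSolution_iff (h : M.IsStable Γ γ c Q W V)
    (f : ℝ → Module.Dual ℝ Q) (g : ℝ → Module.Dual ℝ W) (r : ℝ → Module.Dual ℝ V)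
    (p : ℝ → Q) (w : ℝ → W) (u : ℝ → V) :
    M.IsSemidiscreteSolution Γ γ c Q W V f g r p w u ↔ h.system.IsSolution f g r p w u := by
  have hm := h.system_mass
  have hdar := h.system_darcy
  have hel := h.system_elasticity
  have hw : ∀ t q, M.innerS (divB d ι (w t)) (q : Q) = h.system.m (h.system.divW (w t)) q :=
    fun t q => M.innerS_eq h.two_le _ _
  constructor
  · rintro ⟨h1, h2, h3, h4, h5, h6⟩
    refine ⟨h1, h2, h3, fun t ht q => ?_, fun t ht z => ?_, fun t ht v => ?_⟩
    · simpa only [hm, hw] using h4 t ht q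
    · rw [← hdar]
      exact h5 t ht z
    · rw [← hel]
      exact h6 t ht v
  · rintro ⟨h1, h2, h3, h4, h5, h6⟩
    refine ⟨h1, h2, h3, fun t ht q => ?_, fun t ht z => ?_, fun t ht v => ?_⟩
    · simpa only [hm, hw] using h4 t ht q
    · rw [hdar]
      exact h5 t ht z
    · rw [hel]
      exact h6 t ht v

theorem isHomogeneousSolution_iff (h : M.IsStable Γ γ c Q W V) {σ : ℝ} (hσ : 0 < σ)
    (p : Q) (w : W) (u : V) :
    M.IsHomogeneousSolution Γ γ c Q W V σ p w u ↔ p = 0 ∧ w = 0 ∧ u = 0 := by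
  constructor
  · rintro ⟨h1, h2, h3⟩
    refine h.system.homogeneous_eq_zero hσ (fun q => ?_) (fun z => ?_) fun v => ?_
    · have hq := h1 q q.2
      rw [M.innerS_eq h.two_le, map_smul, LinearMap.smul_apply, ← M.innerS_eq h.two_le,
        h.system_mass, M.innerS_eq h.two_le] at hq
      exact hq
    · rw [← h.system_darcy]
      exact h2 z z.2
    · rw [← h.system_elasticity]
      exact h3 v v.2
  · rintro ⟨rfl, rfl, rfl⟩
    refine ⟨fun q _ => ?_, fun z _ => ?_, fun v _ => ?_⟩ <;>
      simp [M.innerS_eq h.two_le, M.innerV_eq h.two_le, M.aForm_eq h.two_le]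

theorem isWellPosed [FiniteDimensional ℝ Q] [FiniteDimensional ℝ W] [FiniteDimensional ℝ V]
    (h : M.IsStable Γ γ c Q W V) (hc : c.alpha ≠ 0 ∨ 0 < c.cs) :
    M.IsWellPosed Γ γ c Q W V := by
  intro f g r hf hg hr p₀ u₀ h₀
  simp only [h.isSemidiscreteSolution_iff]
  refine h.system.existsUnique_solution hc (.of_dual hf) (.of_dual hg)
    (.of_dual fun v => (hr v).continuousOn) p₀ u₀ fun v => ?_
  rw [← h.system_elasticity]
  exact h₀ v

end IsStable

end Mesh

end Biot

theorem mainTheorem4 {d : ℕ} (hd : 2 ≤ d) {ι I B : Type*} [Fintype ι] [Fintype I] [Fintype B]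
    (M : Biot.Mesh d ι I B) (hΩ : IsConnected M.domain)
    -- the faces where the normal velocity, respectively the displacement, is prescribed
    (ΓpN ΓuD : Finset B) (hΓ : ΓuD.Nonempty)
    -- a divergence conforming space, with the two boundary conditions, and the pressure space
    (X : Submodule ℝ (Biot.Vect d ι)) [FiniteDimensional ℝ X] (hX : ∀ v ∈ X, M.IsHdiv v)
    (W V : Submodule ℝ (Biot.Vect d ι))
    (hW : W = X ⊓ M.normalZero ΓpN) (hV : V = X ⊓ M.normalZero ΓuD)
    (Q : Submodule ℝ (Biot.Scal d ι))
    (hdivW : W.map (Biot.divB d ι) = Q) (hdivV : V.map (Biot.divB d ι) = Q) :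
    (∃ γ₀ : ℝ, 0 < γ₀ ∧ ∀ γ ≥ γ₀, M.Coercive ΓuD γ V) ∧
    ∀ γ : ℝ, 0 < γ → M.Coercive ΓuD γ V →
      ∀ c : Biot.Coefficients d, 0 < c.mu → 0 ≤ c.lam → 0 ≤ c.cs → c.K.PosDef →
        (∀ σ : ℝ, 0 < σ → ∀ (p : Q) (w : W) (u : V),
          M.IsHomogeneousSolution ΓuD γ c Q W V σ p w u ↔ p = 0 ∧ w = 0 ∧ u = 0) ∧
        ((c.alpha ≠ 0 ∨ 0 < c.cs) → M.IsWellPosed ΓuD γ c Q W V) := by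
  have hWfin : FiniteDimensional ℝ W :=
    Submodule.finiteDimensional_of_le (hW.trans_le inf_le_left)
  have hVfin : FiniteDimensional ℝ V :=
    Submodule.finiteDimensional_of_le (hV.trans_le inf_le_left)
  have hQfin : FiniteDimensional ℝ Q :=
    Module.Finite.of_surjective _ (Biot.Mesh.divRestrict_surjective hdivV)
  refine ⟨M.exists_coercive hd hΩ hΓ V, fun γ hγ hcoer c hmu hlam hcs hK =>
    ?_⟩
  have hst : M.IsStable ΓuD γ c Q W V :=
    ⟨hd, hΩ, hΓ, hdivW, hdivV, hγ, hcoer, hmu, hlam, hcs, hK⟩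
  exact ⟨fun σ hσ p w u => hst.isHomogeneousSolution_iff hσ p w u, fun h => hst.isWellPosed h⟩
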